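/- Let $p\ge 5$ be a prime and let $\mathrm{ord}_p$ be the valuation of $\overline{\mathbb Q}_p$ with $\mathrm{ord}_p(p)=1$. Let $\gamma\in\overline{\mathbb Q}_p$ satisfy $\sum_{i\ge 0}\gamma^{p^i}/p^i=0$ and $\mathrm{ord}_p(\gamma)=\frac1{p-1}$, and put $\Omega_0=\mathbb Q_p(\gamma)$. Let $b,b'$ be real numbers with $\frac{p}{p-1}\ge b>\frac1{p-1}$ and $b\ge b'$, and set $\varepsilon=b-\frac1{p-1}$. *Relative theory.* For $\rho\in\mathbb R$ let $$\mathcal L(b';\rho)=\Big\{\sum_{n\ge0}A(n)t^n : A(n)\in\Omega_0,\ \mathrm{ord}_pA(n)\ge 2b'n+\rho\Big\},\qquad \mathcal L(b')=\bigcup_{\rho\in\mathbb R}\mathcal L(b';\rho),$$ and let $\mathcal K(b',b)$ be the space of series $\sum_{n\ge0,\,u\in\mathbb Z}A(n,u)\,t^{n+\max(-u,0)}x^u$ with $A(n,u)\in\Omega_0$ for which there is $\rho\in\mathbb R$ with $\mathrm{ord}_pA(n,u)\ge 2b'n+b|u|+\rho$ for all $n,u$. Let $E(T)=\exp\big(\sum_{i\ge0}T^{p^i}/p^i\big)$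 be the Artin–Hasse exponential, $\theta_\infty(T)=E(\gamma T)$, $F_\infty(t,x)=\theta_\infty(x)\theta_\infty(t/x)$ and $G(t,x)=\prod_{j\ge0}F_\infty(t^{p^j},x^{p^j})\in\Omega_0[[x,t/x]]$. Define $$\widehat D_t=G^{-1}\circ x\tfrac{\partial}{\partial x}\circ G,\qquad \widehat\partial=G^{-1}\circ t\tfrac{\partial}{\partial t}\circ G .$$ There is a unique $2\times2$ matrix $\widehat H=(\widehat H_{ij})_{0\le i,j\le 1}$ with entries in $\mathcal L(b')$ such that $$\widehat\partial(1)\equiv \widehat H_{00}+\widehat H_{01}\tfrac{\gamma t}{x},\qquad \widehat\partial\big(\tfrac{\gamma t}{x}\big)\equiv \widehat H_{10}+\widehat H_{11}\tfrac{\gamma t}{x}\pmod{\widehat D_t\,\mathcal K(b',b)},$$ i.e. the matrix of $\widehat\partial$ on $\mathcal K(b',b)/\widehat D_t\mathcal K(b',b)$ in the basis $\{1,\gamma t/x\}$. *Infinite symmetric power.* Let $\kappa\in\mathbb Z_p\setminus\mathbb Z_{\ge0}$ and $w^{(m)}=\kappa(\kappa-1)\cdots(\kappa-m+1)\,w^m$.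 Inside $\Omega_0[[t,w]]$ let $$\mathcal S(b',\varepsilon;\rho)=\Big\{\sum_{n,m\ge0}A(n,m)t^nw^{(m)} : A(n,m)\in\Omega_0,\ \mathrm{ord}_pA(n,m)\ge2b'n+\varepsilon m+\rho\Big\},\qquad \mathcal S(b',\varepsilon)=\bigcup_{\rho\in\mathbb R}\mathcal S(b',\varepsilon;\rho),$$ and let $\mathcal R(b',\varepsilon;\rho)=\mathcal R(b';\rho)$ and $\mathcal R(b')$ be $\mathcal L(b';\rho)$ and $\mathcal L(b')$, regarded as series without $w$. Let $\widehat\partial_\kappa=t\frac{d}{dt}+\mathcal L_{\kappa,\widehat H}$, where $\mathcal L_{\kappa,\widehat H}$ is the $\Omega_0[[t]]$-linear operator acting termwise on series in $w$ by $$\mathcal L_{\kappa,\widehat H}(w^m)=(\kappa-m)(\widehat H_{00}+\widehat H_{01}w)\,w^m+m\,w^{m-1}(\widehat H_{10}+\widehat H_{11}w).$$ Then $\widehat\partial_\kappa$ maps $\mathcal S(b',\varepsilon)$ into itself, and with $H^0_\kappa(\mathcal S(b',\varepsilon))=\ker(\widehat\partial_\kappa\mid\mathcal S(b',\varepsilon))$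 and $H^1_\kappa(\mathcal S(b',\varepsilon))=\mathcal S(b',\varepsilon)/\widehat\partial_\kappa\mathcal S(b',\varepsilon)$ we have $$H^0_\kappa(\mathcal S(b',\varepsilon))=0,\qquad H^1_\kappa(\mathcal S(b',\varepsilon))\cong\mathcal R(b'),$$ the isomorphism of $\Omega_0$-vector spaces being induced by the inclusion $\mathcal R(b')\subseteq\mathcal S(b',\varepsilon)$. Furthermore $$\mathcal S(b',\varepsilon;0)=\mathcal R(b',\varepsilon;0)\oplus\widehat\partial_\kappa\,\mathcal S(b',\varepsilon;\varepsilon).$$ -/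

import Mathlib

noncomputable section

namespace KloostermanSym

open PowerSeries

variable (p : ℕ) [Fact p.Prime]

/-- The field `Ω₀ = ℚ_p(γ)` inside the algebraic closure of `ℚ_p`. -/
abbrev Omega (γ : PadicAlgCl p) : Type :=
  IntermediateField.adjoin ℚ_[p] ({γ} : Set (PadicAlgCl p))

/-- `ord_p a ≥ r`, where `ord_p` extends the `p`-adic valuation normalized by `ord_p p = 1`
(`ord_p 0 = ∞`); here `‖a‖ = p ^ (-ord_p a)` for `a ≠ 0`. -/
def OrdGE {γ : PadicAlgCl p} (a : Omega p γ) (r : ℝ) : Prop :=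
  ‖(a : PadicAlgCl p)‖ ≤ (p : ℝ) ^ (-r)

/-- `γ` is a root of `∑ T^(p^i) / p^i` with `ord_p γ = 1 / (p - 1)`. -/
structure IsSplittingRoot (γ : PadicAlgCl p) : Prop where
  hasSum : HasSum (fun i : ℕ => γ ^ (p ^ i) / (p : PadicAlgCl p) ^ i) 0
  norm_eq : ‖γ‖ = (p : ℝ) ^ (-(1 / ((p : ℝ) - 1)))

variable (γ : PadicAlgCl p)

/-- `γ` as an element of `Ω₀`. -/
def gam : Omega p γ := IntermediateField.AdjoinSimple.gen ℚ_[p] γ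

/-! ### Growth conditions -/

section Growth

variable {ι : Type} (wt : ι → ℝ)

lemma ordGE_add {a b : Omega p γ} {r : ℝ} (ha : OrdGE p a r) (hb : OrdGE p b r) :
    OrdGE p (a + b) r :=
  (PadicAlgCl.isNonarchimedean p (a : PadicAlgCl p) b).trans (max_le ha hb)

lemma ordGE_zero (r : ℝ) : OrdGE p (0 : Omega p γ) r := by
  simp only [OrdGE, ZeroMemClass.coe_zero, norm_zero]
  positivity

lemma ordGE_neg {a : Omega p γ} {r : ℝ} (ha : OrdGE p a r) : OrdGE p (-a) r := by
  simpa [OrdGE] using ha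

lemma ordGE_mono {a : Omega p γ} {r s : ℝ} (h : s ≤ r) (ha : OrdGE p a r) : OrdGE p a s :=
  ha.trans (Real.rpow_le_rpow_of_exponent_le
    (by exact_mod_cast (Fact.out : p.Prime).one_lt.le) (by linarith))

lemma exists_ordGE (c : Omega p γ) : ∃ s : ℝ, OrdGE p c s := by
  have hp : (1 : ℝ) < p := by exact_mod_cast (Fact.out : p.Prime).one_lt
  obtain ⟨n, hn⟩ := pow_unbounded_of_one_lt ‖(c : PadicAlgCl p)‖ hp
  exact ⟨-n, by simpa [OrdGE] using hn.le⟩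

lemma ordGE_mul {c a : Omega p γ} {s r : ℝ} (hc : OrdGE p c s) (ha : OrdGE p a r) :
    OrdGE p (c * a) (r + s) := by
  have hp : (0 : ℝ) < p := by exact_mod_cast (Fact.out : p.Prime).pos
  simp only [OrdGE] at *
  rw [show -(r + s) = -s + -r by ring, Real.rpow_add hp]
  push_cast
  rw [norm_mul]
  exact mul_le_mul hc ha (norm_nonneg _) (by positivity)

/-- Families `A : ι → Ω₀` with `ord_p A(i) ≥ wt(i) + ρ` for all `i`. -/
def growthAt (ρ : ℝ) : AddSubgroup (ι → Omega p γ) where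
  carrier := {A | ∀ i, OrdGE p (A i) (wt i + ρ)}
  add_mem' ha hb i := ordGE_add p γ (ha i) (hb i)
  zero_mem' _ := ordGE_zero p γ _
  neg_mem' ha i := ordGE_neg p γ (ha i)

/-- The union over `ρ ∈ ℝ` of the groups `growthAt wt ρ`. -/
def growth : Submodule (Omega p γ) (ι → Omega p γ) where
  carrier := {A | ∃ ρ : ℝ, A ∈ growthAt p γ wt ρ}
  add_mem' := by
    rintro A B ⟨ρ, hA⟩ ⟨σ, hB⟩
    exact ⟨min ρ σ, fun i => ordGE_add p γ
      (ordGE_mono p γ (by linarith [min_le_left ρ σ]) (hA i))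
      (ordGE_mono p γ (by linarith [min_le_right ρ σ]) (hB i))⟩
  zero_mem' := ⟨0, AddSubgroup.zero_mem _⟩
  smul_mem' := by
    rintro c A ⟨ρ, hA⟩
    obtain ⟨s, hs⟩ := exists_ordGE p γ c
    refine ⟨ρ + s, fun i => ?_⟩
    have := ordGE_mul p γ hs (hA i)
    rwa [add_assoc] at this

end Growth

/-! ### Power series in `t`: the spaces `ℒ(b'; ρ)` and `ℒ(b')` -/

/-- The coefficients of a power series in `t`. -/
def coeffsL : (Omega p γ)⟦X⟧ →ₗ[Omega p γ] (ℕ → Omega p γ) :=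
  LinearMap.pi fun n => PowerSeries.coeff n

/-- `ℒ(b'; ρ)`: series `∑ A(n) t^n` with `ord_p A(n) ≥ 2 b' n + ρ`. -/
def spaceLAt (b' ρ : ℝ) : AddSubgroup (Omega p γ)⟦X⟧ :=
  (growthAt p γ (fun n : ℕ => 2 * b' * n) ρ).comap (coeffsL p γ).toAddMonoidHom

/-- `ℒ(b')`, the union of the `ℒ(b'; ρ)` over `ρ ∈ ℝ`. -/
def spaceL (b' : ℝ) : Submodule (Omega p γ) (Omega p γ)⟦X⟧ :=
  (growth p γ (fun n : ℕ => 2 * b' * n)).comap (coeffsL p γ)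

/-! ### Relative theory

The series `∑ A(n, u) t^n t^(m(u)) x^u` (`n ≥ 0`, `u ∈ ℤ`, `m(u) = max(-u, 0)`) are exactly the
formal power series in the two variables `x` and `y = t / x`, since
`t^n t^(m(u)) x^u = x^(n + max(u, 0)) y^(n + max(-u, 0))`, a bijection of exponents. We therefore
work in the ring `Ω₀[[x, y]]`, with variable `0` for `x` and variable `1` for `y = t / x`, so that
`t = x y`. -/

/-- The ring `Ω₀[[x, t / x]]`. -/
abbrev RelSeries : Type := MvPowerSeries (Fin 2) (Omega p γ)

/-- The exponent of `t^n t^(m(u)) x^u` in terms of `x` and `y = t / x`. -/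
def relExp (n : ℕ) (u : ℤ) : Fin 2 →₀ ℕ :=
  Finsupp.single 0 (n + u.toNat) + Finsupp.single 1 (n + (-u).toNat)

/-- The coefficients `A(n, u)`. -/
def coeffsK : RelSeries p γ →ₗ[Omega p γ] (ℕ × ℤ → Omega p γ) :=
  LinearMap.pi fun i => MvPowerSeries.coeff (relExp i.1 i.2)

/-- `𝒦(b', b)`: series `∑ A(n, u) t^n t^(m(u)) x^u` such that, for some `ρ ∈ ℝ`,
`ord_p A(n, u) ≥ 2 b' n + b |u| + ρ` for all `n`, `u`. -/
def spaceK (b' b : ℝ) : Submodule (Omega p γ) (RelSeries p γ) :=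
  (growth p γ (fun i : ℕ × ℤ => 2 * b' * i.1 + b * |(i.2 : ℝ)|)).comap (coeffsK p γ)

/-- The inclusion `Ω₀[[t]] ⊆ Ω₀[[x, t / x]]`, `∑ a(n) t^n ↦ ∑ a(n) x^n y^n`. -/
def ofT (f : (Omega p γ)⟦X⟧) : RelSeries p γ :=
  fun d => if d 0 = d 1 then PowerSeries.coeff (d 0) f else 0

/-- The operator multiplying the coefficient of each monomial `d` by the integer `c d`. -/
def euler (c : (Fin 2 →₀ ℕ) → ℤ) : RelSeries p γ →ₗ[Omega p γ] RelSeries p γ where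
  toFun f := fun d => (c d : Omega p γ) * MvPowerSeries.coeff d f
  map_add' f g := by
    funext d
    change _ = (c d : Omega p γ) * MvPowerSeries.coeff d f +
      (c d : Omega p γ) * MvPowerSeries.coeff d g
    rw [map_add, mul_add]
  map_smul' a f := by
    funext d
    change _ = a * ((c d : Omega p γ) * MvPowerSeries.coeff d f)
    rw [map_smul, smul_eq_mul]
    ring

/-- `x ∂/∂x` at constant `t`: the monomial `x^i y^j = t^j x^(i - j)` is multiplied by `i - j`. -/
def xDx : RelSeries p γ →ₗ[Omega p γ] RelSeries p γ := euler p γ fun d => (d 0 : ℤ) - d 1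

/-- `t ∂/∂t` at constant `x`: the monomial `x^i y^j = t^j x^(i - j)` is multiplied by `j`. -/
def tDt : RelSeries p γ →ₗ[Omega p γ] RelSeries p γ := euler p γ fun d => (d 1 : ℤ)

open Classical in
/-- The series `∑_{i ≥ 0} T^(p^i) / p^i`. -/
def artinHasseLog : (Omega p γ)⟦X⟧ :=
  PowerSeries.mk fun n => if ∃ i : ℕ, n = p ^ i then (n : Omega p γ)⁻¹ else 0

/-- The Artin–Hasse exponential `E(T) = exp (∑_{i ≥ 0} T^(p^i) / p^i)`. -/
def artinHasse : (Omega p γ)⟦X⟧ :=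
  (PowerSeries.exp (Omega p γ)).subst (artinHasseLog p γ)

/-- The infinite splitting function `θ_∞(T) = E(γ T)`. -/
def theta : (Omega p γ)⟦X⟧ := PowerSeries.rescale (gam p γ) (artinHasse p γ)

/-- `F_∞(t^(p^j), x^(p^j)) = θ_∞(x^(p^j)) θ_∞((t / x)^(p^j))`. -/
def splitF (j : ℕ) : RelSeries p γ :=
  (theta p γ).subst ((MvPowerSeries.X 0 : RelSeries p γ) ^ p ^ j) *
    (theta p γ).subst ((MvPowerSeries.X 1 : RelSeries p γ) ^ p ^ j)

/-- `G(t, x) = ∏_{j ≥ 0} F_∞(t^(p^j), x^(p^j))`. The `j`-th factor is `1` plus terms of degree at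
least `p^j > j`, so the coefficient of a monomial of degree `D` is already that of the product
over `j ≤ D`. -/
def splitG : RelSeries p γ :=
  fun d => MvPowerSeries.coeff d (∏ j ∈ Finset.range (d.degree + 1), splitF p γ j)

/-- Conjugation `G⁻¹ ∘ δ ∘ G` of an operator by multiplication with `G`. -/
def twist (δ : RelSeries p γ →ₗ[Omega p γ] RelSeries p γ) :
    RelSeries p γ →ₗ[Omega p γ] RelSeries p γ :=
  LinearMap.mulLeft (Omega p γ) (splitG p γ)⁻¹ ∘ₗ δ ∘ₗ
    LinearMap.mulLeft (Omega p γ) (splitG p γ)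

/-- The relative boundary operator `D̂_t = G⁻¹ ∘ x ∂/∂x ∘ G`. -/
def hatD : RelSeries p γ →ₗ[Omega p γ] RelSeries p γ := twist p γ (xDx p γ)

/-- The Gauss–Manin connection `∂̂ = G⁻¹ ∘ t ∂/∂t ∘ G`. -/
def hatPartial : RelSeries p γ →ₗ[Omega p γ] RelSeries p γ := twist p γ (tDt p γ)

/-- The elements `1` and `γ t / x`, whose classes form the basis of `H¹_t`. -/
def relBasis : Fin 2 → RelSeries p γ :=
  ![1, MvPowerSeries.C (gam p γ) * MvPowerSeries.X 1]

/-- `Ĥ` is the matrix (acting on row vectors) of `∂̂` on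
`H¹_t(𝒦(b', b)) = 𝒦(b', b) / D̂_t 𝒦(b', b)` with respect to `e₀ = 1`, `e₁ = γ t / x`: its entries
lie in `ℒ(b')` and `∂̂(e_i) ≡ ∑_j Ĥ_{ij} e_j` modulo `D̂_t 𝒦(b', b)`. -/
structure IsGaussManinMatrix (b' b : ℝ) (H : Matrix (Fin 2) (Fin 2) (Omega p γ)⟦X⟧) : Prop where
  mem : ∀ i j, H i j ∈ spaceL p γ b'
  congr : ∀ i, hatPartial p γ (relBasis p γ i) - ∑ j, ofT p γ (H i j) * relBasis p γ j ∈
    (spaceK p γ b' b).map (hatD p γ)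

/-! ### The infinite symmetric power -/

/-- `Ω₀[[t, w]]`, as power series in `w` with coefficients in `Ω₀[[t]]`. -/
abbrev SymSeries : Type := PowerSeries (PowerSeries (Omega p γ))

/-- A `p`-adic integer as an element of `Ω₀`. -/
def ofPadicInt (κ : ℤ_[p]) : Omega p γ := algebraMap ℚ_[p] (Omega p γ) (κ : ℚ_[p])

/-- The falling factorial `κ (κ - 1) ⋯ (κ - m + 1)` in `Ω₀`. -/
def fallingFactorial (κ : ℤ_[p]) (m : ℕ) : Omega p γ :=
  ofPadicInt p γ (∏ i ∈ Finset.range m, (κ - (i : ℤ_[p])))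

/-- The series `∑ A(n, m) t^n w^((m))`, where `w^((m)) = κ (κ - 1) ⋯ (κ - m + 1) w^m`. -/
def symSeries (κ : ℤ_[p]) : (ℕ × ℕ → Omega p γ) →ₗ[Omega p γ] SymSeries p γ where
  toFun A := PowerSeries.mk fun m => PowerSeries.mk fun n => A (n, m) * fallingFactorial p γ κ m
  map_add' A B := by
    ext m n
    simp [add_mul]
  map_smul' c A := by
    ext m n
    simp [mul_assoc]

/-- `𝒮(b', ε; ρ)`: series `∑ A(n, m) t^n w^((m))` with `ord_p A(n, m) ≥ 2 b' n + ε m + ρ`. -/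
def spaceSAt (κ : ℤ_[p]) (b' ε ρ : ℝ) : AddSubgroup (SymSeries p γ) :=
  (growthAt p γ (fun i : ℕ × ℕ => 2 * b' * i.1 + ε * i.2) ρ).map
    (symSeries p γ κ).toAddMonoidHom

/-- `𝒮(b', ε)`, the union of the `𝒮(b', ε; ρ)` over `ρ ∈ ℝ`. -/
def spaceS (κ : ℤ_[p]) (b' ε : ℝ) : Submodule (Omega p γ) (SymSeries p γ) :=
  (growth p γ (fun i : ℕ × ℕ => 2 * b' * i.1 + ε * i.2)).map (symSeries p γ κ)

/-- The inclusion `Ω₀[[t]] ⊆ Ω₀[[t, w]]`. -/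
def constW : (Omega p γ)⟦X⟧ →ₗ[Omega p γ] SymSeries p γ where
  toFun f := PowerSeries.C f
  map_add' := map_add _
  map_smul' c f := by
    ext m n
    simp only [PowerSeries.coeff_C, RingHom.id_apply, PowerSeries.coeff_smul]
    split_ifs <;> simp

/-- `ℛ(b'; ρ)`, the image of `ℒ(b'; ρ)`. -/
def spaceRAt (b' ρ : ℝ) : AddSubgroup (SymSeries p γ) :=
  (spaceLAt p γ b' ρ).map (constW p γ).toAddMonoidHom

/-- `ℛ(b')`, the image of `ℒ(b')`. -/
def spaceR (b' : ℝ) : Submodule (Omega p γ) (SymSeries p γ) :=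
  (spaceL p γ b').map (constW p γ)

/-- `t d/dt`, coefficientwise in `w`. -/
def tDeriv : SymSeries p γ →ₗ[Omega p γ] SymSeries p γ where
  toFun F := PowerSeries.mk fun m =>
    PowerSeries.mk fun n => (n : Omega p γ) * PowerSeries.coeff n (PowerSeries.coeff m F)
  map_add' F G := by
    ext m n
    simp [mul_add]
  map_smul' c F := by
    ext m n
    simp [mul_left_comm]

/-- For a matrix `M` acting on row vectors, `M(1) = M₀₀ + M₀₁ w` (row `0`) and
`M(w) = M₁₀ + M₁₁ w` (row `1`). -/
def rowW (M : Matrix (Fin 2) (Fin 2) (Omega p γ)⟦X⟧) (i : Fin 2) : SymSeries p γ :=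
  PowerSeries.C (M i 0) + PowerSeries.C (M i 1) * PowerSeries.X

/-- The `Ω₀[[t]]`-linear operator `ℒ_{κ, M}` on `Ω₀[[t, w]]` with
`w^m ↦ (κ - m) M(1) w^m + m w^(m - 1) M(w)`: summed over all monomials of `F` this is
`M(1) (κ F - w dF/dw) + M(w) dF/dw` (see `lieOp_X_pow`). -/
def lieOp (κ : ℤ_[p]) (M : Matrix (Fin 2) (Fin 2) (Omega p γ)⟦X⟧) :
    SymSeries p γ →ₗ[Omega p γ] SymSeries p γ where
  toFun F :=
    rowW p γ M 0 * (ofPadicInt p γ κ • F -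
      PowerSeries.X * PowerSeries.derivative (Omega p γ)⟦X⟧ F) +
    rowW p γ M 1 * PowerSeries.derivative (Omega p γ)⟦X⟧ F
  map_add' F G := by
    simp only [map_add, smul_add]
    ring
  map_smul' c F := by
    have h : PowerSeries.derivative (Omega p γ)⟦X⟧ (c • F) =
        c • PowerSeries.derivative (Omega p γ)⟦X⟧ F := by
      ext m n
      simp [PowerSeries.coeff_derivative, mul_comm]
    rw [h, smul_comm (ofPadicInt p γ κ) c F, mul_smul_comm, ← smul_sub, mul_smul_comm,
      mul_smul_comm, ← smul_add, RingHom.id_apply]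

lemma lieOp_X_pow (κ : ℤ_[p]) (M : Matrix (Fin 2) (Fin 2) (Omega p γ)⟦X⟧) (m : ℕ) :
    lieOp p γ κ M (PowerSeries.X ^ m) =
      (ofPadicInt p γ κ - (m : Omega p γ)) • (rowW p γ M 0 * PowerSeries.X ^ m) +
        (m : SymSeries p γ) * PowerSeries.X ^ (m - 1) * rowW p γ M 1 := by
  have hd : PowerSeries.derivative (Omega p γ)⟦X⟧ (PowerSeries.X ^ m) =
      (m : SymSeries p γ) * PowerSeries.X ^ (m - 1) := by
    rw [PowerSeries.derivative_pow, PowerSeries.derivative_X, mul_one]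
  have hx : (PowerSeries.X : SymSeries p γ) * ((m : SymSeries p γ) * PowerSeries.X ^ (m - 1)) =
      (m : Omega p γ) • (PowerSeries.X ^ m : SymSeries p γ) := by
    rw [Nat.cast_smul_eq_nsmul, nsmul_eq_mul]
    rcases m with _ | m
    · simp
    · rw [Nat.add_sub_cancel]
      ring
  change rowW p γ M 0 * (ofPadicInt p γ κ • _ - PowerSeries.X * _) + rowW p γ M 1 * _ = _
  rw [hd, hx, ← sub_smul, mul_smul_comm, mul_comm (rowW p γ M 1)]

/-- The boundary operator `∂̂_κ = t d/dt + ℒ_{κ, Ĥ}`, for a matrix `Ĥ`. -/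
def hatPartialSym (κ : ℤ_[p]) (H : Matrix (Fin 2) (Fin 2) (Omega p γ)⟦X⟧) :
    SymSeries p γ →ₗ[Omega p γ] SymSeries p γ :=
  tDeriv p γ + lieOp p γ κ H

/-- `H⁰_κ(𝒮(b', ε)) = ker (∂̂_κ | 𝒮(b', ε))`. -/
def cohomZero (κ : ℤ_[p]) (b' ε : ℝ) (H : Matrix (Fin 2) (Fin 2) (Omega p γ)⟦X⟧) :
    Submodule (Omega p γ) (spaceS p γ κ b' ε) :=
  LinearMap.ker ((hatPartialSym p γ κ H).domRestrict (spaceS p γ κ b' ε))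

/-- `H¹_κ(𝒮(b', ε)) = 𝒮(b', ε) / ∂̂_κ 𝒮(b', ε)`. -/
abbrev CohomOne (κ : ℤ_[p]) (b' ε : ℝ) (H : Matrix (Fin 2) (Fin 2) (Omega p γ)⟦X⟧) : Type :=
  spaceS p γ κ b' ε ⧸
    ((spaceS p γ κ b' ε).map (hatPartialSym p γ κ H)).submoduleOf (spaceS p γ κ b' ε)

lemma spaceR_le_spaceS (κ : ℤ_[p]) (b' ε : ℝ) : spaceR p γ b' ≤ spaceS p γ κ b' ε := by
  rintro _ ⟨f, ⟨ρ, hf⟩, rfl⟩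
  refine ⟨fun i => if i.2 = 0 then PowerSeries.coeff i.1 f else 0, ⟨ρ, ?_⟩, ?_⟩
  · rintro ⟨n, m⟩
    rcases m with _ | m
    · simpa [coeffsL] using hf n
    · simpa using ordGE_zero p γ _
  · ext m n
    rcases m with _ | m
    · simp [symSeries, constW, fallingFactorial, ofPadicInt]
    · simp [symSeries, constW]

/-- The map `ℛ(b') → H¹_κ(𝒮(b', ε))` induced by the inclusion `ℛ(b') ⊆ 𝒮(b', ε)`. -/
def toCohomOne (κ : ℤ_[p]) (b' ε : ℝ) (H : Matrix (Fin 2) (Fin 2) (Omega p γ)⟦X⟧) :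
    spaceR p γ b' →ₗ[Omega p γ] CohomOne p γ κ b' ε H :=
  Submodule.mkQ _ ∘ₗ Submodule.inclusion (spaceR_le_spaceS p γ κ b' ε)

end KloostermanSym

end

noncomputable section

namespace KloostermanSym

open PowerSeries

variable (p : ℕ) [Fact p.Prime]
variable (γ : PadicAlgCl p)

/-! ### The order function -/

section Order

variable {p γ}

lemma one_lt_cast_prime : (1 : ℝ) < p := by exact_mod_cast (Fact.out : p.Prime).one_lt

lemma ordGE_sub {a b : Omega p γ} {r : ℝ} (ha : OrdGE p a r) (hb : OrdGE p b r) :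
    OrdGE p (a - b) r := by
  rw [sub_eq_add_neg]
  exact ordGE_add p γ ha (ordGE_neg p γ hb)

lemma ordGE_sum {α : Type*} (s : Finset α) (f : α → Omega p γ) {r : ℝ}
    (h : ∀ i ∈ s, OrdGE p (f i) r) : OrdGE p (∑ i ∈ s, f i) r := by
  classical
  induction s using Finset.induction_on with
  | empty => simpa using ordGE_zero p γ r
  | insert a s ha ih =>
    rw [Finset.sum_insert ha]
    exact ordGE_add p γ (h a (Finset.mem_insert_self a s))
      (ih fun i hi => h i (Finset.mem_insert_of_mem hi))

lemma ordGE_mul_of_le {a b : Omega p γ} {r s q : ℝ} (ha : OrdGE p a r) (hb : OrdGE p b s)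
    (h : q ≤ r + s) : OrdGE p (a * b) q :=
  ordGE_mono p γ (by linarith) (ordGE_mul p γ ha hb)

lemma ordGE_iff_norm {a : Omega p γ} {r : ℝ} : OrdGE p a r ↔ ‖a‖ ≤ (p : ℝ) ^ (-r) := Iff.rfl

lemma ordGE_ofPadicInt (κ : ℤ_[p]) : OrdGE p (ofPadicInt p γ κ) 0 := by
  have h : ‖((ofPadicInt p γ κ : Omega p γ) : PadicAlgCl p)‖ = ‖(κ : ℚ_[p])‖ :=
    PadicAlgCl.norm_extends p (κ : ℚ_[p])
  rw [OrdGE, h, neg_zero, Real.rpow_zero]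
  exact PadicInt.norm_le_one κ

@[simp] lemma ofPadicInt_natCast (n : ℕ) : ofPadicInt p γ (n : ℤ_[p]) = n := by
  simp [ofPadicInt]

@[simp] lemma ofPadicInt_sub (x y : ℤ_[p]) :
    ofPadicInt p γ (x - y) = ofPadicInt p γ x - ofPadicInt p γ y := by
  simp [ofPadicInt]

@[simp] lemma ofPadicInt_mul (x y : ℤ_[p]) :
    ofPadicInt p γ (x * y) = ofPadicInt p γ x * ofPadicInt p γ y := by
  simp [ofPadicInt]

lemma ofPadicInt_injective : Function.Injective (ofPadicInt p γ) := fun _ _ h =>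
  Subtype.ext ((algebraMap ℚ_[p] (Omega p γ)).injective h)

lemma ordGE_natCast (n : ℕ) : OrdGE p (n : Omega p γ) 0 := by
  rw [← ofPadicInt_natCast]
  exact ordGE_ofPadicInt _

lemma ordGE_intCast (n : ℤ) : OrdGE p (n : Omega p γ) 0 := by
  have h : (n : Omega p γ) = ofPadicInt p γ (n : ℤ_[p]) := by simp [ofPadicInt]
  rw [h]
  exact ordGE_ofPadicInt _

lemma ordGE_one : OrdGE p (1 : Omega p γ) 0 := by
  simpa using ordGE_natCast (p := p) (γ := γ) 1

lemma eq_zero_of_forall_ordGE {a : Omega p γ} {r ε : ℝ} (hε : 0 < ε)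
    (h : ∀ n : ℕ, OrdGE p a (r + n * ε)) : a = 0 := by
  have hp := one_lt_cast_prime (p := p)
  have hp0 : (0 : ℝ) < p := by linarith
  have hq : (p : ℝ) ^ (-ε) < 1 := Real.rpow_lt_one_of_one_lt_of_neg hp (by linarith)
  have ht : Filter.Tendsto (fun n : ℕ => (p : ℝ) ^ (-r) * ((p : ℝ) ^ (-ε)) ^ n) Filter.atTop
      (nhds ((p : ℝ) ^ (-r) * 0)) :=
    (tendsto_pow_atTop_nhds_zero_of_lt_one (by positivity) hq).const_mul _
  rw [mul_zero] at ht
  have hle : ‖a‖ ≤ 0 := by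
    refine ge_of_tendsto' ht fun n => ?_
    have := h n
    rw [ordGE_iff_norm] at this
    refine this.trans_eq ?_
    rw [← Real.rpow_natCast, ← Real.rpow_mul hp0.le, ← Real.rpow_add hp0]
    ring_nf
  exact norm_le_zero_iff.mp hle

instance completeSpace_Omega : CompleteSpace (Omega p γ) := by
  have : FiniteDimensional ℚ_[p] (Omega p γ) :=
    IntermediateField.adjoin.finiteDimensional (Algebra.IsIntegral.isIntegral γ)
  exact FiniteDimensional.complete ℚ_[p] (Omega p γ)

/-- A series whose terms have order growing linearly converges, with control of the tails. -/
lemma exists_sum_of_ordGE {a : ℕ → Omega p γ} {r ε : ℝ} (hε : 0 < ε)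
    (h : ∀ n, OrdGE p (a n) (r + n * ε)) :
    ∃ s, ∀ N : ℕ, OrdGE p (s - ∑ n ∈ Finset.range N, a n) (r + N * ε) := by
  have hp := one_lt_cast_prime (p := p)
  have hp0 : (0 : ℝ) < p := by linarith
  have hq : (p : ℝ) ^ (-ε) < 1 := Real.rpow_lt_one_of_one_lt_of_neg hp (by linarith)
  have hsum : Summable a := by
    refine Summable.of_norm_bounded (g := fun n => (p : ℝ) ^ (-r) * ((p : ℝ) ^ (-ε)) ^ n)
      ((summable_geometric_of_lt_one (by positivity) hq).mul_left _) fun n => ?_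
    have := h n
    rw [ordGE_iff_norm] at this
    refine this.trans_eq ?_
    rw [← Real.rpow_natCast, ← Real.rpow_mul hp0.le, ← Real.rpow_add hp0]
    ring_nf
  refine ⟨∑' n, a n, fun N => ?_⟩
  have ht := (hsum.hasSum.tendsto_sum_nat.sub_const (∑ n ∈ Finset.range N, a n)).norm
  rw [ordGE_iff_norm]
  refine le_of_tendsto ht (Filter.eventually_atTop.mpr ⟨N, fun M hM => ?_⟩)
  rw [← Finset.sum_Ico_eq_sub _ hM, ← ordGE_iff_norm]
  refine ordGE_sum _ _ fun i hi => ordGE_mono p γ ?_ (h i)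
  have : (N : ℝ) ≤ i := by exact_mod_cast (Finset.mem_Ico.mp hi).1
  nlinarith

end Order

/-! ### Perturbation of a division with remainder -/

section Perturbation

variable {p γ} {ι : Type} {wt : ι → ℝ}

lemma growthAt_mono {r s : ℝ} (h : s ≤ r) {A : ι → Omega p γ} (hA : A ∈ growthAt p γ wt r) :
    A ∈ growthAt p γ wt s :=
  fun i => ordGE_mono p γ (by linarith) (hA i)

/-- The families vanishing on a set `Z` of indices. -/
def vanishing (p : ℕ) [Fact p.Prime] (γ : PadicAlgCl p) (Z : Set ι) :
    AddSubgroup (ι → Omega p γ) where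
  carrier := {v | ∀ i ∈ Z, v i = 0}
  add_mem' ha hb i hi := by simp [ha i hi, hb i hi]
  zero_mem' _ _ := rfl
  neg_mem' ha i hi := by simp [ha i hi]

lemma eq_zero_of_forall_mem_growthAt {A : ι → Omega p γ} {r ε : ℝ} (hε : 0 < ε)
    (h : ∀ n : ℕ, A ∈ growthAt p γ wt (r + n * ε)) : A = 0 :=
  funext fun i => eq_zero_of_forall_ordGE (r := wt i + r) hε fun n => by
    simpa only [add_assoc] using h n i

lemma mem_vanishing_of_approx {Z : Set ι} {v : ι → Omega p γ} {r ε : ℝ} (hε : 0 < ε)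
    (h : ∀ n : ℕ, ∃ w ∈ vanishing p γ Z, v - w ∈ growthAt p γ wt (r + n * ε)) :
    v ∈ vanishing p γ Z := fun i hi =>
  eq_zero_of_forall_ordGE (r := wt i + r) hε fun n => by
    obtain ⟨w, hw, hvw⟩ := h n
    have := hvw i
    rw [Pi.sub_apply, hw i hi, sub_zero] at this
    simpa only [add_assoc] using this

lemma exists_sum_of_mem_growthAt {a : ℕ → ι → Omega p γ} {r ε : ℝ} (hε : 0 < ε)
    (h : ∀ n : ℕ, a n ∈ growthAt p γ wt (r + n * ε)) :
    ∃ s, ∀ N : ℕ, s - ∑ n ∈ Finset.range N, a n ∈ growthAt p γ wt (r + N * ε) := by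
  have key (i : ι) := exists_sum_of_ordGE (a := fun n => a n i) (r := wt i + r) hε fun n => by
    simpa only [add_assoc] using h n i
  choose s hs using key
  refine ⟨s, fun N i => ?_⟩
  have := hs i N
  rw [Pi.sub_apply, Finset.sum_apply]
  simpa only [add_assoc] using this

variable (wt) in
/-- A division with remainder: every element of level `σ` is, modulo the families vanishing on
`Z`, uniquely of the form `D₀ k` with `k` of level `σ + ε`; and `E` is an operator of strictly
smaller size than `D₀`. -/
structure IsDivision (Z : Set ι) (ε : ℝ) (D₀ E : (ι → Omega p γ) →+ (ι → Omega p γ)) : Prop where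
  pos : 0 < ε
  lead_mem : ∀ σ, ∀ v ∈ growthAt p γ wt σ, D₀ v ∈ growthAt p γ wt (σ - ε)
  pert_mem : ∀ σ, ∀ v ∈ growthAt p γ wt σ, E v ∈ growthAt p γ wt σ
  exists_quot : ∀ σ, ∀ v ∈ growthAt p γ wt σ,
    ∃ k ∈ growthAt p γ wt (σ + ε), v - D₀ k ∈ vanishing p γ Z
  eq_zero : ∀ k, D₀ k ∈ vanishing p γ Z → k = 0

namespace IsDivision

variable {Z : Set ι} {ε : ℝ} {D₀ E : (ι → Omega p γ) →+ (ι → Omega p γ)}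

lemma apply_mem (h : IsDivision wt Z ε D₀ E) {σ : ℝ} {v : ι → Omega p γ}
    (hv : v ∈ growthAt p γ wt σ) : (D₀ + E) v ∈ growthAt p γ wt (σ - ε) :=
  add_mem (h.lead_mem σ v hv) (growthAt_mono (by linarith [h.pos]) (h.pert_mem σ v hv))

lemma mem_of_lead_sub_mem (h : IsDivision wt Z ε D₀ E) {σ : ℝ} {v k : ι → Omega p γ}
    (hv : v ∈ growthAt p γ wt σ) (hk : v - D₀ k ∈ vanishing p γ Z) :
    k ∈ growthAt p γ wt (σ + ε) := by
  obtain ⟨k', hk', hr⟩ := h.exists_quot σ v hv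
  have : D₀ (k - k') ∈ vanishing p γ Z := by
    have := sub_mem hr hk
    rwa [sub_sub_sub_cancel_left, ← map_sub] at this
  rwa [sub_eq_zero.mp (h.eq_zero _ this)]

/-- The perturbed operator has no nonzero element of finite level mapping into the remainders. -/
lemma eq_zero_of_add_mem (h : IsDivision wt Z ε D₀ E) {ρ : ℝ} {k : ι → Omega p γ}
    (hk : k ∈ growthAt p γ wt ρ) (hD : (D₀ + E) k ∈ vanishing p γ Z) : k = 0 := by
  refine eq_zero_of_forall_mem_growthAt (wt := wt) (r := ρ) h.pos fun n => ?_
  induction n with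
  | zero => simpa using hk
  | succ n ih =>
    have := h.mem_of_lead_sub_mem (k := -k) (h.pert_mem _ _ ih) (by
      rw [map_neg, sub_neg_eq_add, add_comm]
      exact hD)
    rw [Nat.cast_succ, add_one_mul, ← add_assoc]
    exact neg_mem_iff.mp this

/-- Division with remainder by the perturbed operator. The remainder agrees to first order with
that of the division by the leading operator. -/
lemma exists_add_quot (h : IsDivision wt Z ε D₀ E) {ρ : ℝ} {v k₀ : ι → Omega p γ}
    (hv : v ∈ growthAt p γ wt ρ) (hk₀ : v - D₀ k₀ ∈ vanishing p γ Z) :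
    ∃ k ∈ growthAt p γ wt (ρ + ε), v - (D₀ + E) k ∈ vanishing p γ Z ∧
      (v - (D₀ + E) k) - (v - D₀ k₀) ∈ growthAt p γ wt (ρ + ε) := by
  classical
  have hε := h.pos
  choose! q hq hqr using h.exists_quot
  let x : ℕ → (ι → Omega p γ) := fun n => Nat.rec v (fun n x => -E (q (ρ + n * ε) x)) n
  have hx (n : ℕ) : x n ∈ growthAt p γ wt (ρ + n * ε) := by
    induction n with
    | zero => simpa [x] using hv
    | succ n ih =>
      rw [Nat.cast_succ, add_one_mul, ← add_assoc]
      exact neg_mem (h.pert_mem _ _ (hq _ _ ih))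
  let a : ℕ → (ι → Omega p γ) := fun n => q (ρ + n * ε) (x n)
  have ha (n : ℕ) : a n ∈ growthAt p γ wt (ρ + ε + n * ε) := by
    rw [add_right_comm]
    exact hq _ _ (hx n)
  have har (n : ℕ) : x n - D₀ (a n) ∈ vanishing p γ Z := hqr _ _ (hx n)
  obtain ⟨k, hk⟩ := exists_sum_of_mem_growthAt hε ha
  have hk0 : k ∈ growthAt p γ wt (ρ + ε) := by simpa using hk 0
  have hpart (N : ℕ) : v - (D₀ + E) (∑ n ∈ Finset.range N, a n) - x N ∈ vanishing p γ Z := by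
    induction N with
    | zero => simp [x]
    | succ N ih =>
      have h1 : v - (D₀ + E) (∑ n ∈ Finset.range (N + 1), a n) - x (N + 1) =
          (v - (D₀ + E) (∑ n ∈ Finset.range N, a n) - x N) + (x N - D₀ (a N)) := by
        have : x (N + 1) = -E (a N) := rfl
        rw [Finset.sum_range_succ, map_add, this, AddMonoidHom.add_apply D₀ E (a N)]
        abel
      rw [h1]
      exact add_mem ih (har N)
  refine ⟨k, hk0, mem_vanishing_of_approx (wt := wt) (r := ρ) hε fun N => ⟨_, hpart N, ?_⟩, ?_⟩
  · have h1 := h.apply_mem (hk N)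
    rw [map_sub, show ρ + ε + N * ε - ε = ρ + N * ε by ring] at h1
    have h2 := sub_mem (hx N) h1
    convert h2 using 1
    abel
  · have h0 : k₀ = a 0 := by
      have := sub_mem (har 0) (show x 0 - D₀ k₀ ∈ vanishing p γ Z from hk₀)
      rw [sub_sub_sub_cancel_left, ← map_sub] at this
      exact sub_eq_zero.mp (h.eq_zero _ this)
    have h1 := hk 1
    rw [Finset.sum_range_one, ← h0, Nat.cast_one, one_mul] at h1
    have h2 := h.lead_mem _ _ h1
    rw [add_sub_cancel_right] at h2
    have h3 := neg_mem (add_mem h2 (h.pert_mem _ _ hk0))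
    convert h3 using 1
    rw [map_sub, AddMonoidHom.add_apply]
    abel

end IsDivision

end Perturbation

/-! ### Multiplication and growth -/

section Multiplication

variable {p γ} {σ : Type} {wt : (σ →₀ ℕ) → ℝ}

lemma mul_mem_growthAt (hwt : ∀ d e, wt (d + e) ≤ wt d + wt e)
    {f g : MvPowerSeries σ (Omega p γ)} {r s : ℝ}
    (hf : f ∈ growthAt p γ wt r) (hg : g ∈ growthAt p γ wt s) :
    f * g ∈ growthAt p γ wt (r + s) := by
  classical
  intro d
  change OrdGE p (MvPowerSeries.coeff d (f * g)) _
  rw [MvPowerSeries.coeff_mul]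
  refine ordGE_sum _ _ fun x hx => ordGE_mul_of_le (hf x.1) (hg x.2) ?_
  have := hwt x.1 x.2
  rw [Finset.HasAntidiagonal.mem_antidiagonal.mp hx] at this
  linarith

lemma inv_mem_growthAt [Finite σ] (hwt : ∀ d e, wt (d + e) ≤ wt d + wt e) (hwt0 : wt 0 = 0)
    {f : MvPowerSeries σ (Omega p γ)} (hf : f ∈ growthAt p γ wt 0)
    (hf0 : MvPowerSeries.constantCoeff f = 1) : f⁻¹ ∈ growthAt p γ wt 0 := by
  classical
  intro d
  change OrdGE p (MvPowerSeries.coeff d f⁻¹) _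
  induction d using WellFoundedLT.induction with
  | ind d ih =>
    rw [MvPowerSeries.coeff_inv, hf0]
    split_ifs with hd
    · rw [hd, hwt0, add_zero, inv_one]
      exact ordGE_one
    · rw [inv_one, neg_one_mul]
      refine ordGE_neg p γ (ordGE_sum _ _ fun x hx => ?_)
      split_ifs with hlt
      · refine ordGE_mul_of_le (hf x.1) (ih x.2 hlt) ?_
        have := hwt x.1 x.2
        rw [Finset.HasAntidiagonal.mem_antidiagonal.mp hx] at this
        linarith
      · exact ordGE_zero p γ _

/-- The weight of a monomial in `t`. -/
def weightL (b' : ℝ) (d : Unit →₀ ℕ) : ℝ := 2 * b' * d ()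

lemma weightL_add (b' : ℝ) (d e : Unit →₀ ℕ) :
    weightL b' (d + e) ≤ weightL b' d + weightL b' e := by
  simp [weightL, mul_add]

lemma mem_spaceLAt {b' ρ : ℝ} {f : (Omega p γ)⟦X⟧} :
    f ∈ spaceLAt p γ b' ρ ↔ ∀ n : ℕ, OrdGE p (PowerSeries.coeff n f) (2 * b' * n + ρ) := Iff.rfl

lemma mem_spaceL {b' : ℝ} {f : (Omega p γ)⟦X⟧} :
    f ∈ spaceL p γ b' ↔ ∃ ρ, f ∈ spaceLAt p γ b' ρ := Iff.rfl

lemma mem_spaceLAt_iff_growthAt {b' ρ : ℝ} {f : (Omega p γ)⟦X⟧} :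
    f ∈ spaceLAt p γ b' ρ ↔ f ∈ growthAt p γ (weightL b') ρ := by
  rw [mem_spaceLAt]
  constructor
  · intro h d
    have := h (d ())
    rwa [PowerSeries.coeff_def (s := d) rfl] at this
  · intro h n
    have := h (Finsupp.single () n)
    rwa [weightL, Finsupp.single_eq_same] at this

lemma spaceLAt_mono {b' r s : ℝ} (h : s ≤ r) {f : (Omega p γ)⟦X⟧}
    (hf : f ∈ spaceLAt p γ b' r) : f ∈ spaceLAt p γ b' s :=
  fun n => ordGE_mono p γ (by linarith) (hf n)

lemma mul_mem_spaceLAt {b' r s : ℝ} {f g : (Omega p γ)⟦X⟧} (hf : f ∈ spaceLAt p γ b' r)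
    (hg : g ∈ spaceLAt p γ b' s) : f * g ∈ spaceLAt p γ b' (r + s) := by
  rw [mem_spaceLAt_iff_growthAt] at *
  exact mul_mem_growthAt (weightL_add b') hf hg

lemma smul_mem_spaceLAt {b' r : ℝ} {c : Omega p γ} {f : (Omega p γ)⟦X⟧} (hc : OrdGE p c 0)
    (hf : f ∈ spaceLAt p γ b' r) : c • f ∈ spaceLAt p γ b' r := fun n => by
  change OrdGE p (PowerSeries.coeff n (c • f)) _
  rw [PowerSeries.coeff_smul, smul_eq_mul]
  exact ordGE_mul_of_le hc (hf n) (by linarith)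

lemma exists_mul_eq_one_of_mem_spaceLAt {b' : ℝ} {f : (Omega p γ)⟦X⟧}
    (hf : f ∈ spaceLAt p γ b' 0) (hf0 : PowerSeries.constantCoeff f = 1) :
    ∃ g ∈ spaceLAt p γ b' 0, f * g = 1 := by
  rw [mem_spaceLAt_iff_growthAt] at hf
  refine ⟨(show MvPowerSeries Unit (Omega p γ) from f)⁻¹, ?_, ?_⟩
  · rw [mem_spaceLAt_iff_growthAt]
    exact inv_mem_growthAt (weightL_add b') (by simp [weightL]) hf hf0
  · exact MvPowerSeries.mul_inv_cancel _ (by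
      rw [show MvPowerSeries.constantCoeff f = 1 from hf0]
      exact one_ne_zero)

end Multiplication

/-! ### The coefficients `p^l γ_l` of the logarithmic derivative of `G` -/

section LogCoeff

/-- The coefficient of `x^n` in `x G'/G`: for `n = p^l` it is `p^l ∑_{i ≤ l} γ^(p^i) / p^i`. -/
def logCoeff (n : ℕ) : Omega p γ :=
  if n = p ^ Nat.log p n then
    ∑ i ∈ Finset.range (Nat.log p n + 1), (p : Omega p γ) ^ (Nat.log p n - i) * gam p γ ^ p ^ i
  else 0

variable {p γ}

lemma logCoeff_pow (l : ℕ) : logCoeff p γ (p ^ l) =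
    ∑ i ∈ Finset.range (l + 1), (p : Omega p γ) ^ (l - i) * gam p γ ^ p ^ i := by
  rw [logCoeff, Nat.log_pow (Fact.out : p.Prime).one_lt, if_pos rfl]

lemma logCoeff_of_ne {n : ℕ} (h : ∀ l, n ≠ p ^ l) : logCoeff p γ n = 0 :=
  if_neg (h _)

@[simp] lemma logCoeff_zero : logCoeff p γ 0 = 0 :=
  logCoeff_of_ne fun l => (pow_pos (Fact.out : p.Prime).pos l).ne

@[simp] lemma logCoeff_one : logCoeff p γ 1 = gam p γ := by
  have := logCoeff_pow (p := p) (γ := γ) 0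
  simpa using this

lemma logCoeff_even (hp : 5 ≤ p) (n : ℕ) : logCoeff p γ (2 * n) = 0 := by
  refine logCoeff_of_ne fun l hl => ?_
  have hodd : Odd (p ^ l) := ((Fact.out : p.Prime).odd_of_ne_two (by omega)).pow
  rw [← hl] at hodd
  exact (Nat.not_odd_iff_even.mpr (even_two_mul n)) hodd

lemma norm_prime_cast : ‖(p : Omega p γ)‖ = (p : ℝ)⁻¹ := by
  have h : ‖((p : Omega p γ) : PadicAlgCl p)‖ = ‖(p : ℚ_[p])‖ := by
    rw [← PadicAlgCl.norm_extends]
    simp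
  exact h.trans (Padic.norm_p)

lemma norm_gam (hγ : IsSplittingRoot p γ) :
    ‖gam p γ‖ = (p : ℝ) ^ (-(1 / ((p : ℝ) - 1))) := hγ.norm_eq

lemma ordGE_gam (hγ : IsSplittingRoot p γ) : OrdGE p (gam p γ) (1 / ((p : ℝ) - 1)) :=
  (norm_gam hγ).le

lemma gam_ne_zero (hγ : IsSplittingRoot p γ) : gam p γ ≠ 0 := by
  rw [← norm_pos_iff, norm_gam hγ]
  have := one_lt_cast_prime (p := p)
  positivity

lemma ordGE_inv_gam (hγ : IsSplittingRoot p γ) : OrdGE p (gam p γ)⁻¹ (-(1 / ((p : ℝ) - 1))) := by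
  rw [ordGE_iff_norm, norm_inv, norm_gam hγ, Real.rpow_neg (Nat.cast_nonneg p) (- _)]

lemma norm_gam_pow_div (hγ : IsSplittingRoot p γ) (i : ℕ) :
    ‖gam p γ ^ p ^ i / (p : Omega p γ) ^ i‖ =
      (p : ℝ) ^ (-((p : ℝ) ^ i / ((p : ℝ) - 1) - i)) := by
  have hp := one_lt_cast_prime (p := p)
  have hp0 : (0 : ℝ) < p := by linarith
  rw [norm_div, norm_pow, norm_pow, norm_gam hγ, norm_prime_cast, ← Real.rpow_natCast,
    ← Real.rpow_mul hp0.le, inv_pow, div_inv_eq_mul, ← Real.rpow_natCast (p : ℝ) i,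
    ← Real.rpow_add hp0]
  congr 1
  push_cast
  rw [Real.rpow_natCast]
  ring

lemma pow_div_sub_mono {l i : ℕ} (h : l ≤ i) :
    (p : ℝ) ^ l / ((p : ℝ) - 1) - l ≤ (p : ℝ) ^ i / ((p : ℝ) - 1) - i := by
  have hp := one_lt_cast_prime (p := p)
  induction i, h using Nat.le_induction with
  | base => exact le_rfl
  | succ i _ ih =>
    refine ih.trans ?_
    have h1 : (p : ℝ) ^ (i + 1) / ((p : ℝ) - 1) = (p : ℝ) ^ i / ((p : ℝ) - 1) + (p : ℝ) ^ i := by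
      have : (p : ℝ) - 1 ≠ 0 := by linarith
      field_simp
      ring
    have h2 := one_le_pow₀ hp.le (n := i)
    rw [h1]
    push_cast
    linarith

lemma ordGE_partial_sum (hγ : IsSplittingRoot p γ) (l : ℕ) :
    OrdGE p (∑ i ∈ Finset.range l, gam p γ ^ p ^ i / (p : Omega p γ) ^ i)
      ((p : ℝ) ^ l / ((p : ℝ) - 1) - l) := by
  have hs := hγ.hasSum.tendsto_sum_nat
  have hc (N : ℕ) : ∑ i ∈ Finset.range N, γ ^ p ^ i / (p : PadicAlgCl p) ^ i =
      ((∑ i ∈ Finset.range N, gam p γ ^ p ^ i / (p : Omega p γ) ^ i : Omega p γ) :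
        PadicAlgCl p) := by
    rw [← IntermediateField.algebraMap_apply, map_sum]
    refine Finset.sum_congr rfl fun i _ => ?_
    rw [map_div₀, map_pow, map_pow, map_natCast]
    rfl
  simp only [hc] at hs
  have ht := (hs.sub_const
    ((∑ i ∈ Finset.range l, gam p γ ^ p ^ i / (p : Omega p γ) ^ i : Omega p γ) :
        PadicAlgCl p)).norm
  rw [zero_sub, norm_neg] at ht
  refine le_of_tendsto ht (Filter.eventually_atTop.mpr ⟨l, fun M hM => ?_⟩)
  rw [← AddSubgroupClass.coe_sub, ← Finset.sum_Ico_eq_sub _ hM]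
  refine ordGE_sum _ _ fun i hi => ordGE_mono p γ ?_ (norm_gam_pow_div hγ i).le
  exact pow_div_sub_mono (Finset.mem_Ico.mp hi).1

lemma ordGE_logCoeff (hγ : IsSplittingRoot p γ) {b : ℝ} (hb : b ≤ (p : ℝ) / ((p : ℝ) - 1))
    (n : ℕ) : OrdGE p (logCoeff p γ (n + 1)) (b * n + 1 / ((p : ℝ) - 1)) := by
  have hp := one_lt_cast_prime (p := p)
  have hp0 : (p : Omega p γ) ≠ 0 := by
    exact_mod_cast (Fact.out : p.Prime).ne_zero
  by_cases h : ∃ l, n + 1 = p ^ l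
  · obtain ⟨l, hl⟩ := h
    have h1 : logCoeff p γ (n + 1) = (p : Omega p γ) ^ l *
        ∑ i ∈ Finset.range (l + 1), gam p γ ^ p ^ i / (p : Omega p γ) ^ i := by
      rw [hl, logCoeff_pow, Finset.mul_sum]
      refine Finset.sum_congr rfl fun i hi => ?_
      rw [pow_sub₀ _ hp0 (Nat.lt_succ_iff.mp (Finset.mem_range.mp hi))]
      ring
    have h2 : OrdGE p ((p : Omega p γ) ^ l) l := by
      rw [ordGE_iff_norm, norm_pow, norm_prime_cast, Real.rpow_neg (by linarith), inv_pow,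
        Real.rpow_natCast]
    rw [h1]
    refine ordGE_mul_of_le h2 (ordGE_partial_sum hγ (l + 1)) ?_
    have h3 : (n : ℝ) = (p : ℝ) ^ l - 1 := by
      rw [eq_sub_iff_add_eq]
      exact_mod_cast hl
    have h4 : b * n ≤ (p : ℝ) / ((p : ℝ) - 1) * n :=
      mul_le_mul_of_nonneg_right hb (Nat.cast_nonneg n)
    have h5 : (p : ℝ) / ((p : ℝ) - 1) * ((p : ℝ) ^ l - 1) + 1 / ((p : ℝ) - 1) =
        (p : ℝ) ^ (l + 1) / ((p : ℝ) - 1) - 1 := by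
      have : (p : ℝ) - 1 ≠ 0 := by linarith
      field_simp
      ring
    rw [h3] at h4 ⊢
    push_cast
    linarith
  · push Not at h
    rw [logCoeff_of_ne h]
    exact ordGE_zero p γ _

end LogCoeff

/-! ### Division by `x - y` in the relative theory -/

section RelDivision

/-- The exponent of `x^i y^j`. -/
def relMon (i j : ℕ) : Fin 2 →₀ ℕ := Finsupp.single 0 i + Finsupp.single 1 j

@[simp] lemma relMon_zero (i j : ℕ) : relMon i j 0 = i := by simp [relMon]

@[simp] lemma relMon_one (i j : ℕ) : relMon i j 1 = j := by simp [relMon]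

lemma relMon_self (d : Fin 2 →₀ ℕ) : relMon (d 0) (d 1) = d := by
  ext s
  fin_cases s <;> simp

/-- The weight of a monomial `x^i y^j = t^(min(i, j)) t^(m(i - j)) x^(i - j)`. -/
def weightK (b' b : ℝ) (d : Fin 2 →₀ ℕ) : ℝ :=
  b * (d 0 + d 1) - 2 * (b - b') * min (d 0 : ℝ) (d 1)

lemma weightK_relExp (b' b : ℝ) (n : ℕ) (u : ℤ) :
    weightK b' b (relExp n u) = 2 * b' * n + b * |(u : ℝ)| := by
  have h0 : relExp n u 0 = n + u.toNat := by simp [relExp]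
  have h1 : relExp n u 1 = n + (-u).toNat := by simp [relExp]
  rw [weightK, h0, h1]
  rcases le_total 0 u with hu | hu
  · lift u to ℕ using hu
    simp
    ring
  · obtain ⟨k, rfl⟩ : ∃ k : ℕ, u = -k := ⟨u.natAbs, by omega⟩
    simp
    ring

lemma exists_relExp_eq (d : Fin 2 →₀ ℕ) : ∃ n u, relExp n u = d := by
  refine ⟨min (d 0) (d 1), (d 0 : ℤ) - d 1, ?_⟩
  ext s
  fin_cases s
  · simp [relExp]
    omega
  · simp [relExp]
    omega

lemma weightK_add {b' b : ℝ} (h : b' ≤ b) (d e : Fin 2 →₀ ℕ) :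
    weightK b' b (d + e) ≤ weightK b' b d + weightK b' b e := by
  have hmin : min (d 0 : ℝ) (d 1) + min (e 0 : ℝ) (e 1) ≤ min ((d + e) 0 : ℕ) ((d + e) 1 : ℕ) := by
    push_cast [Finsupp.add_apply]
    exact min_add_min_le_min_add_add
  have := mul_le_mul_of_nonneg_left hmin (show 0 ≤ 2 * (b - b') by linarith)
  simp only [weightK]
  push_cast [Finsupp.add_apply] at this ⊢
  linarith

lemma weightK_of_le {b' b : ℝ} {i j : ℕ} (h : i ≤ j) :
    weightK b' b (relMon i j) = 2 * b' * i + b * ((j : ℝ) - i) := by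
  have : (i : ℝ) ≤ j := by exact_mod_cast h
  rw [weightK, relMon_zero, relMon_one, min_eq_left this]
  ring

lemma weightK_of_ge {b' b : ℝ} {i j : ℕ} (h : j ≤ i) :
    weightK b' b (relMon i j) = 2 * b' * j + b * ((i : ℝ) - j) := by
  have : (j : ℝ) ≤ i := by exact_mod_cast h
  rw [weightK, relMon_zero, relMon_one, min_eq_right this]
  ring

variable {p γ}

lemma mem_spaceK {b' b : ℝ} {f : RelSeries p γ} :
    f ∈ spaceK p γ b' b ↔ ∃ ρ, f ∈ growthAt p γ (weightK b' b) ρ := by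
  constructor
  · rintro ⟨ρ, hf⟩
    refine ⟨ρ, fun d => ?_⟩
    obtain ⟨n, u, rfl⟩ := exists_relExp_eq d
    rw [weightK_relExp]
    exact hf (n, u)
  · rintro ⟨ρ, hf⟩
    refine ⟨ρ, fun i => ?_⟩
    have := hf (relExp i.1 i.2)
    rw [weightK_relExp] at this
    exact this

lemma coeff_X_zero_mul (g : RelSeries p γ) (i j : ℕ) :
    MvPowerSeries.coeff (relMon (i + 1) j) (MvPowerSeries.X 0 * g) =
      MvPowerSeries.coeff (relMon i j) g := by
  rw [show relMon (i + 1) j = Finsupp.single 0 1 + relMon i j by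
    simp only [relMon, Finsupp.single_add]; abel, MvPowerSeries.X_def,
    MvPowerSeries.coeff_add_monomial_mul, one_mul]

lemma coeff_X_one_mul (g : RelSeries p γ) (i j : ℕ) :
    MvPowerSeries.coeff (relMon i (j + 1)) (MvPowerSeries.X 1 * g) =
      MvPowerSeries.coeff (relMon i j) g := by
  rw [show relMon i (j + 1) = Finsupp.single 1 1 + relMon i j by
    simp only [relMon, Finsupp.single_add]; abel, MvPowerSeries.X_def,
    MvPowerSeries.coeff_add_monomial_mul, one_mul]

lemma coeff_X_mul_eq_zero (g : RelSeries p γ) {d : Fin 2 →₀ ℕ} {s : Fin 2} (h : d s = 0) :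
    MvPowerSeries.coeff d (MvPowerSeries.X s * g) = 0 := by
  classical
  rw [MvPowerSeries.X_def, MvPowerSeries.coeff_monomial_mul, if_neg]
  intro hle
  have := hle s
  simp [h] at this

/-- The exponents not of the form `x^n y^n` or `x^n y^(n + 1)`. -/
def offDiagonal : Set (Fin 2 →₀ ℕ) := {d | d 1 ≠ d 0 ∧ d 1 ≠ d 0 + 1}

/-- Coefficients below the diagonal of the quotient by `x - y`. -/
def quotBelow (v : RelSeries p γ) : ℕ → ℕ → Omega p γ
  | 0, j => -MvPowerSeries.coeff (relMon 0 (j + 1)) v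
  | i + 1, j => quotBelow v i (j + 1) - MvPowerSeries.coeff (relMon (i + 1) (j + 1)) v

/-- Coefficients above the diagonal of the quotient by `x - y`. -/
def quotAbove (v : RelSeries p γ) : ℕ → ℕ → Omega p γ
  | 0, i => MvPowerSeries.coeff (relMon (i + 1) 0) v
  | j + 1, i => quotAbove v j (i + 1) + MvPowerSeries.coeff (relMon (i + 1) (j + 1)) v

/-- The quotient of the division by `x - y`. -/
def quotXSubY (v : RelSeries p γ) : RelSeries p γ := fun d =>
  if d 0 < d 1 then quotBelow v (d 0) (d 1) else quotAbove v (d 1) (d 0)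

lemma coeff_quotXSubY_of_lt (v : RelSeries p γ) {i j : ℕ} (h : i < j) :
    MvPowerSeries.coeff (relMon i j) (quotXSubY v) = quotBelow v i j := by
  change (if _ then _ else _) = _
  simp [h]

lemma coeff_quotXSubY_of_ge (v : RelSeries p γ) {i j : ℕ} (h : j ≤ i) :
    MvPowerSeries.coeff (relMon i j) (quotXSubY v) = quotAbove v j i := by
  change (if _ then _ else _) = _
  simp [h]

lemma sub_mul_quotXSubY_mem (v : RelSeries p γ) :
    v - (MvPowerSeries.X 0 - MvPowerSeries.X 1) * quotXSubY v ∈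
      vanishing p γ offDiagonal := by
  rintro d ⟨h1, h2⟩
  change MvPowerSeries.coeff d (v - (MvPowerSeries.X 0 - MvPowerSeries.X 1) * quotXSubY v) = 0
  rw [sub_mul, map_sub, map_sub]
  rw [← relMon_self d]
  generalize d 0 = i at *
  generalize d 1 = j at *
  rcases lt_or_ge i j with hij | hij
  · obtain ⟨j, rfl⟩ : ∃ k, j = k + 1 := ⟨j - 1, by omega⟩
    rw [coeff_X_one_mul, coeff_quotXSubY_of_lt v (by omega)]
    rcases i with _ | i
    · rw [coeff_X_mul_eq_zero _ (relMon_zero _ _), quotBelow]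
      ring
    · rw [coeff_X_zero_mul, coeff_quotXSubY_of_lt v (by omega), quotBelow]
      ring
  · obtain ⟨i, rfl⟩ : ∃ k, i = k + 1 := ⟨i - 1, by omega⟩
    rw [coeff_X_zero_mul, coeff_quotXSubY_of_ge v (by omega)]
    rcases j with _ | j
    · rw [coeff_X_mul_eq_zero _ (relMon_one _ _), quotAbove]
      ring
    · rw [coeff_X_one_mul, coeff_quotXSubY_of_ge v (by omega), quotAbove]
      ring

lemma eq_zero_of_X_sub_mul_mem {g : RelSeries p γ}
    (h : (MvPowerSeries.X 0 - MvPowerSeries.X 1) * g ∈ vanishing p γ offDiagonal) : g = 0 := by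
  have key (i j : ℕ) (h1 : j ≠ i) (h2 : j ≠ i + 1) :
      MvPowerSeries.coeff (relMon i j) (MvPowerSeries.X 0 * g) =
        MvPowerSeries.coeff (relMon i j) (MvPowerSeries.X 1 * g) := by
    have := h (relMon i j) ⟨by simpa using h1, by simpa using h2⟩
    change MvPowerSeries.coeff (relMon i j) ((MvPowerSeries.X 0 - MvPowerSeries.X 1) * g) = 0
      at this
    rwa [sub_mul, map_sub, sub_eq_zero] at this
  have below (i : ℕ) : ∀ j, i < j → MvPowerSeries.coeff (relMon i j) g = 0 := by
    induction i with
    | zero =>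
      intro j hj
      rw [← coeff_X_one_mul, ← key _ _ (by omega) (by omega),
        coeff_X_mul_eq_zero _ (relMon_zero _ _)]
    | succ i ih =>
      intro j hj
      rw [← coeff_X_one_mul, ← key _ _ (by omega) (by omega), coeff_X_zero_mul,
        ih _ (by omega)]
  have above (j : ℕ) : ∀ i, j ≤ i → MvPowerSeries.coeff (relMon i j) g = 0 := by
    induction j with
    | zero =>
      intro i hi
      rw [← coeff_X_zero_mul, key _ _ (by omega) (by omega),
        coeff_X_mul_eq_zero _ (relMon_one _ _)]
    | succ j ih =>
      intro i hi
      rw [← coeff_X_zero_mul, key _ _ (by omega) (by omega), coeff_X_one_mul,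
        ih _ (by omega)]
  refine MvPowerSeries.ext fun d => ?_
  rw [← relMon_self d, MvPowerSeries.coeff_zero]
  rcases lt_or_ge (d 0) (d 1) with hd | hd
  · exact below _ _ hd
  · exact above _ _ hd

lemma quotXSubY_mem {b' b ρ : ℝ} (hb : b' ≤ b) {v : RelSeries p γ}
    (hv : v ∈ growthAt p γ (weightK b' b) ρ) :
    quotXSubY v ∈ growthAt p γ (weightK b' b) (ρ + b) := by
  have hv' (i j : ℕ) : OrdGE p (MvPowerSeries.coeff (relMon i j) v)
    (weightK b' b (relMon i j) + ρ) := hv _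
  have below (i : ℕ) : ∀ j, i < j →
      OrdGE p (quotBelow v i j) (weightK b' b (relMon i j) + (ρ + b)) := by
    induction i with
    | zero =>
      intro j hj
      refine ordGE_neg p γ (ordGE_mono p γ ?_ (hv' _ _))
      rw [weightK_of_le hj.le, weightK_of_le (by omega)]
      push_cast
      linarith
    | succ i ih =>
      intro j hj
      refine ordGE_sub (ordGE_mono p γ ?_ (ih (j + 1) (by omega)))
        (ordGE_mono p γ ?_ (hv' _ _))
      · rw [weightK_of_le hj.le, weightK_of_le (by omega)]
        push_cast
        linarith
      · rw [weightK_of_le hj.le, weightK_of_le (by omega)]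
        push_cast
        linarith
  have above (j : ℕ) : ∀ i, j ≤ i →
      OrdGE p (quotAbove v j i) (weightK b' b (relMon i j) + (ρ + b)) := by
    induction j with
    | zero =>
      intro i hi
      refine ordGE_mono p γ ?_ (hv' _ _)
      rw [weightK_of_ge hi, weightK_of_ge (by omega)]
      push_cast
      linarith
    | succ j ih =>
      intro i hi
      refine ordGE_add p γ (ordGE_mono p γ ?_ (ih (i + 1) (by omega)))
        (ordGE_mono p γ ?_ (hv' _ _))
      · rw [weightK_of_ge hi, weightK_of_ge (by omega)]
        push_cast
        linarith
      · rw [weightK_of_ge hi, weightK_of_ge (by omega)]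
        push_cast
        linarith
  intro d
  change OrdGE p (MvPowerSeries.coeff d (quotXSubY v)) _
  rw [← relMon_self d]
  rcases lt_or_ge (d 0) (d 1) with hd | hd
  · rw [coeff_quotXSubY_of_lt v hd]
    exact below _ _ hd
  · rw [coeff_quotXSubY_of_ge v hd]
    exact above _ _ hd

end RelDivision

/-! ### The relative boundary operator as a perturbed division -/

section RelPerturbation

/-- The logarithmic derivative of `G` in the variable `x`. -/
def logX : RelSeries p γ := fun d => if d 1 = 0 then logCoeff p γ (d 0) else 0

/-- The logarithmic derivative of `G` in the variable `y`. -/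
def logY : RelSeries p γ := fun d => if d 0 = 0 then logCoeff p γ (d 1) else 0

/-- The quotient `(logX - logY) / (γ (x - y))`. -/
def unitU : RelSeries p γ := fun d => (gam p γ)⁻¹ * logCoeff p γ (d 0 + d 1 + 1)

variable {p γ}

lemma coeff_logX (i j : ℕ) : MvPowerSeries.coeff (relMon i j) (logX p γ) =
    if j = 0 then logCoeff p γ i else 0 := by
  change (if _ then _ else _) = _
  simp

lemma coeff_logY (i j : ℕ) : MvPowerSeries.coeff (relMon i j) (logY p γ) =
    if i = 0 then logCoeff p γ j else 0 := by
  change (if _ then _ else _) = _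
  simp

lemma coeff_unitU (i j : ℕ) : MvPowerSeries.coeff (relMon i j) (unitU p γ) =
    (gam p γ)⁻¹ * logCoeff p γ (i + j + 1) := by
  change (gam p γ)⁻¹ * _ = _
  simp

lemma logX_sub_logY (hγ : IsSplittingRoot p γ) :
    logX p γ - logY p γ =
      MvPowerSeries.C (gam p γ) * ((MvPowerSeries.X 0 - MvPowerSeries.X 1) * unitU p γ) := by
  have hg := gam_ne_zero hγ
  ext d : 1
  rw [← relMon_self d]
  generalize d 0 = i
  generalize d 1 = j
  rw [map_sub, coeff_logX, coeff_logY, MvPowerSeries.coeff_C_mul, sub_mul, map_sub]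
  rcases i with _ | i <;> rcases j with _ | j
  · rw [coeff_X_mul_eq_zero _ (relMon_one _ _), coeff_X_mul_eq_zero _ (relMon_zero _ _)]
    simp
  · rw [coeff_X_mul_eq_zero _ (relMon_zero _ _), coeff_X_one_mul, coeff_unitU]
    simp [hg]
  · rw [coeff_X_mul_eq_zero _ (relMon_one _ _), coeff_X_zero_mul, coeff_unitU]
    simp [hg]
  · rw [coeff_X_zero_mul, coeff_X_one_mul, coeff_unitU, coeff_unitU]
    simp [add_right_comm, add_assoc]

lemma constantCoeff_unitU (hγ : IsSplittingRoot p γ) :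
    MvPowerSeries.constantCoeff (unitU p γ) = 1 := by
  change (gam p γ)⁻¹ * _ = _
  simp [gam_ne_zero hγ]

lemma weightK_le {b' b : ℝ} (hb' : b' ≤ b) (d : Fin 2 →₀ ℕ) :
    weightK b' b d ≤ b * (d 0 + d 1) := by
  have : 0 ≤ 2 * (b - b') * min (d 0 : ℝ) (d 1) := by
    have : 0 ≤ min (d 0 : ℝ) (d 1) := le_min (Nat.cast_nonneg _) (Nat.cast_nonneg _)
    have : 0 ≤ b - b' := by linarith
    positivity
  rw [weightK]
  linarith

variable {b b' : ℝ}

lemma unitU_mem (hγ : IsSplittingRoot p γ) (hb : b ≤ (p : ℝ) / ((p : ℝ) - 1)) (hb' : b' ≤ b) :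
    unitU p γ ∈ growthAt p γ (weightK b' b) 0 := fun d => by
  refine ordGE_mul_of_le (ordGE_inv_gam hγ) (ordGE_logCoeff hγ hb _) ?_
  have := weightK_le hb' d
  push_cast
  linarith

lemma inv_unitU_mem (hγ : IsSplittingRoot p γ) (hb : b ≤ (p : ℝ) / ((p : ℝ) - 1))
    (hb' : b' ≤ b) : (unitU p γ)⁻¹ ∈ growthAt p γ (weightK b' b) 0 :=
  inv_mem_growthAt (weightK_add hb') (by simp [weightK]) (unitU_mem hγ hb hb')
    (constantCoeff_unitU hγ)

lemma ordGE_logCoeff' (hγ : IsSplittingRoot p γ) (hb : b ≤ (p : ℝ) / ((p : ℝ) - 1)) (n : ℕ) :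
    OrdGE p (logCoeff p γ n) (b * n - (b - 1 / ((p : ℝ) - 1))) := by
  rcases n with _ | n
  · rw [logCoeff_zero]
    exact ordGE_zero p γ _
  · refine ordGE_mono p γ ?_ (ordGE_logCoeff hγ hb n)
    push_cast
    linarith

lemma logX_mem (hγ : IsSplittingRoot p γ) (hb : b ≤ (p : ℝ) / ((p : ℝ) - 1)) (hb' : b' ≤ b) :
    logX p γ ∈ growthAt p γ (weightK b' b) (-(b - 1 / ((p : ℝ) - 1))) := fun d => by
  rw [logX]
  split_ifs with h
  · refine ordGE_mono p γ ?_ (ordGE_logCoeff' hγ hb _)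
    have := weightK_le hb' d
    rw [h] at this
    push_cast at this
    linarith
  · exact ordGE_zero p γ _

lemma logY_mem (hγ : IsSplittingRoot p γ) (hb : b ≤ (p : ℝ) / ((p : ℝ) - 1)) (hb' : b' ≤ b) :
    logY p γ ∈ growthAt p γ (weightK b' b) (-(b - 1 / ((p : ℝ) - 1))) := fun d => by
  rw [logY]
  split_ifs with h
  · refine ordGE_mono p γ ?_ (ordGE_logCoeff' hγ hb _)
    have := weightK_le hb' d
    rw [h] at this
    push_cast at this
    linarith
  · exact ordGE_zero p γ _

variable (p γ) in
/-- Multiplication by `logX - logY`, the leading part of `D̂_t`. -/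
def relLead : ((Fin 2 →₀ ℕ) → Omega p γ) →+ ((Fin 2 →₀ ℕ) → Omega p γ) :=
  (LinearMap.mulLeft (Omega p γ) (logX p γ - logY p γ)).toAddMonoidHom

variable (p γ) in
/-- The operator `x ∂/∂x`, the perturbation in `D̂_t`. -/
def relPert : ((Fin 2 →₀ ℕ) → Omega p γ) →+ ((Fin 2 →₀ ℕ) → Omega p γ) :=
  (xDx p γ).toAddMonoidHom

lemma euler_mem {c : (Fin 2 →₀ ℕ) → ℤ} {wt : (Fin 2 →₀ ℕ) → ℝ} {ρ : ℝ} {v : RelSeries p γ}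
    (hv : v ∈ growthAt p γ wt ρ) : euler p γ c v ∈ growthAt p γ wt ρ := fun d =>
  ordGE_mul_of_le (ordGE_intCast (c d)) (hv d) (by linarith)

lemma smul_mem_growthAt {ι : Type} {wt : ι → ℝ} {r s : ℝ} {c : Omega p γ} {v : ι → Omega p γ}
    (hc : OrdGE p c s) (hv : v ∈ growthAt p γ wt r) : c • v ∈ growthAt p γ wt (r + s) := fun i =>
  ordGE_mul_of_le hc (hv i) (by linarith)

lemma isDivision_rel (hγ : IsSplittingRoot p γ) (hb0 : 1 / ((p : ℝ) - 1) < b)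
    (hb : b ≤ (p : ℝ) / ((p : ℝ) - 1)) (hb' : b' ≤ b) :
    IsDivision (weightK b' b) offDiagonal (b - 1 / ((p : ℝ) - 1)) (relLead p γ)
      (relPert p γ) := by
  have hg := gam_ne_zero hγ
  have hU0 : MvPowerSeries.constantCoeff (unitU p γ) ≠ 0 := by
    rw [constantCoeff_unitU hγ]
    exact one_ne_zero
  have hlead (v : RelSeries p γ) : (relLead p γ v : RelSeries p γ) =
      ((MvPowerSeries.X 0 - MvPowerSeries.X 1) * (unitU p γ * (gam p γ • v)) :
        RelSeries p γ) := by
    change (logX p γ - logY p γ) * v = _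
    rw [logX_sub_logY hγ, MvPowerSeries.smul_eq_C_mul]
    ring
  refine ⟨by linarith, fun σ v hv => ?_, fun σ v hv => euler_mem hv, fun σ v hv => ?_,
    fun k hk => ?_⟩
  · have := mul_mem_growthAt (weightK_add hb')
      (sub_mem (logX_mem hγ hb hb') (logY_mem hγ hb hb')) hv
    rw [neg_add_eq_sub] at this
    exact this
  · refine ⟨(gam p γ)⁻¹ • ((unitU p γ)⁻¹ * quotXSubY v : RelSeries p γ), ?_, ?_⟩
    · have := smul_mem_growthAt (ordGE_inv_gam hγ)
        (mul_mem_growthAt (weightK_add hb') (inv_unitU_mem hγ hb hb') (quotXSubY_mem hb' hv))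
      rwa [show σ + (b - 1 / ((p : ℝ) - 1)) = 0 + (σ + b) + -(1 / ((p : ℝ) - 1)) by ring]
    · have h1 := hlead ((gam p γ)⁻¹ • ((unitU p γ)⁻¹ * quotXSubY v : RelSeries p γ))
      rw [smul_inv_smul₀ hg, ← mul_assoc (unitU p γ), MvPowerSeries.mul_inv_cancel _ hU0,
        one_mul] at h1
      have h2 := sub_mul_quotXSubY_mem v
      rwa [← show _ = _ from h1] at h2
  · rw [show relLead p γ k = _ from hlead k] at hk
    have h1 := eq_zero_of_X_sub_mul_mem hk
    have h2 : gam p γ • (show RelSeries p γ from k) = 0 := by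
      have := congrArg (fun f => (unitU p γ)⁻¹ * f) h1
      simp only [← mul_assoc, MvPowerSeries.inv_mul_cancel _ hU0, one_mul, mul_zero] at this
      exact this
    exact (smul_eq_zero.mp h2).resolve_left hg

end RelPerturbation

/-! ### The logarithmic derivatives of `G` -/

section LogDerivative

variable {p γ}

@[simp] lemma coeff_euler (c : (Fin 2 →₀ ℕ) → ℤ) (f : RelSeries p γ) (d : Fin 2 →₀ ℕ) :
    MvPowerSeries.coeff d (euler p γ c f) = (c d : Omega p γ) * MvPowerSeries.coeff d f := rfl

lemma euler_mul {c : (Fin 2 →₀ ℕ) → ℤ} (hc : ∀ d e, c (d + e) = c d + c e)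
    (f g : RelSeries p γ) :
    euler p γ c (f * g) = euler p γ c f * g + f * euler p γ c g := by
  classical
  refine MvPowerSeries.ext fun d => ?_
  rw [coeff_euler, map_add, MvPowerSeries.coeff_mul, MvPowerSeries.coeff_mul,
    MvPowerSeries.coeff_mul, Finset.mul_sum, ← Finset.sum_add_distrib]
  refine Finset.sum_congr rfl fun x hx => ?_
  rw [← Finset.HasAntidiagonal.mem_antidiagonal.mp hx, hc, coeff_euler, coeff_euler]
  push_cast
  ring

lemma hasSubst_X_pow (s : Fin 2) {k : ℕ} (hk : k ≠ 0) :
    PowerSeries.HasSubst ((MvPowerSeries.X s : RelSeries p γ) ^ k) :=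
  PowerSeries.HasSubst.of_constantCoeff_zero (by simp [hk])

lemma coeff_subst_X_pow (s : Fin 2) {k : ℕ} (hk : k ≠ 0) (f : (Omega p γ)⟦X⟧)
    (d : Fin 2 →₀ ℕ) :
    MvPowerSeries.coeff d (f.subst ((MvPowerSeries.X s : RelSeries p γ) ^ k)) =
      if d = Finsupp.single s (d s) ∧ k ∣ d s then PowerSeries.coeff (d s / k) f else 0 := by
  classical
  rw [PowerSeries.coeff_subst (hasSubst_X_pow s hk)]
  simp only [← pow_mul, MvPowerSeries.coeff_X_pow]
  split_ifs with h
  · obtain ⟨hd, n, hn⟩ := h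
    rw [finsum_eq_single _ n]
    · rw [if_pos (by rw [← hn]; exact hd), hn, Nat.mul_div_cancel_left _ (Nat.pos_of_ne_zero hk)]
      simp
    · intro m hm
      rw [if_neg, smul_zero]
      intro hd'
      rw [hd] at hd'
      have := Finsupp.single_injective s hd'
      rw [hn] at this
      exact hm (Nat.eq_of_mul_eq_mul_left (Nat.pos_of_ne_zero hk) this.symm)
  · refine (finsum_congr fun n => ?_).trans finsum_zero
    rw [if_neg, smul_zero]
    intro hd
    refine h ⟨?_, n, ?_⟩
    · rw [hd]
      simp
    · rw [hd]
      simp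

lemma euler_single {c : (Fin 2 →₀ ℕ) → ℤ} (hc : ∀ d e, c (d + e) = c d + c e) (s : Fin 2)
    (n : ℕ) : c (Finsupp.single s n) = n * c (Finsupp.single s 1) := by
  induction n with
  | zero =>
    have := hc 0 0
    simp at this
    simp [this]
  | succ n ih =>
    rw [Finsupp.single_add, hc, ih]
    push_cast
    ring

lemma euler_subst {c : (Fin 2 →₀ ℕ) → ℤ} (hc : ∀ d e, c (d + e) = c d + c e) (s : Fin 2)
    {k : ℕ} (hk : k ≠ 0) (f : (Omega p γ)⟦X⟧) :
    euler p γ c (f.subst ((MvPowerSeries.X s : RelSeries p γ) ^ k)) =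
      ((c (Finsupp.single s 1) : Omega p γ) * k) •
        (X * PowerSeries.derivative (Omega p γ) f).subst
          ((MvPowerSeries.X s : RelSeries p γ) ^ k) := by
  refine MvPowerSeries.ext fun d => ?_
  rw [coeff_euler, MvPowerSeries.coeff_smul, coeff_subst_X_pow s hk, coeff_subst_X_pow s hk]
  split_ifs with h
  · obtain ⟨hd, n, hn⟩ := h
    have h1 : c d = d s * c (Finsupp.single s 1) := by
      rw [← euler_single hc, ← hd]
    rw [h1, hn, Nat.mul_div_cancel_left _ (Nat.pos_of_ne_zero hk)]
    rcases n with _ | n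
    · simp
    · rw [PowerSeries.coeff_succ_X_mul, PowerSeries.coeff_derivative]
      push_cast
      ring
  · simp

variable (p γ) in
open Classical in
/-- The logarithmic derivative `∑ (γ T)^(p^i)` of `θ_∞`. -/
def thetaLog : (Omega p γ)⟦X⟧ :=
  PowerSeries.mk fun n => if ∃ i : ℕ, n = p ^ i then gam p γ ^ n else 0

lemma coeff_zero_artinHasseLog : PowerSeries.constantCoeff (artinHasseLog p γ) = 0 := by
  rw [← PowerSeries.coeff_zero_eq_constantCoeff_apply, artinHasseLog, PowerSeries.coeff_mk, if_neg]
  rintro ⟨i, hi⟩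
  exact (pow_pos (Fact.out : p.Prime).pos i).ne hi

lemma X_mul_derivative_artinHasse :
    X * PowerSeries.derivative (Omega p γ) (artinHasse p γ) =
      artinHasse p γ * (X * PowerSeries.derivative (Omega p γ) (artinHasseLog p γ)) := by
  rw [artinHasse, PowerSeries.derivative_subst
    (PowerSeries.HasSubst.of_constantCoeff_zero' coeff_zero_artinHasseLog),
    PowerSeries.derivative_exp]
  ring

lemma X_mul_derivative_rescale (a : Omega p γ) (f : (Omega p γ)⟦X⟧) :
    X * PowerSeries.derivative (Omega p γ) (PowerSeries.rescale a f) =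
      PowerSeries.rescale a (X * PowerSeries.derivative (Omega p γ) f) := by
  refine PowerSeries.ext fun n => ?_
  rw [PowerSeries.coeff_rescale]
  rcases n with _ | n
  · simp
  · rw [PowerSeries.coeff_succ_X_mul, PowerSeries.coeff_succ_X_mul, PowerSeries.coeff_derivative,
      PowerSeries.coeff_derivative, PowerSeries.coeff_rescale]
    ring

lemma X_mul_derivative_theta :
    X * PowerSeries.derivative (Omega p γ) (theta p γ) = theta p γ * thetaLog p γ := by
  rw [theta, X_mul_derivative_rescale, X_mul_derivative_artinHasse, map_mul]
  congr 1
  refine PowerSeries.ext fun n => ?_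
  rw [PowerSeries.coeff_rescale, thetaLog, PowerSeries.coeff_mk]
  rcases n with _ | n
  · rw [if_neg]
    · simp
    · rintro ⟨i, hi⟩
      exact (pow_pos (Fact.out : p.Prime).pos i).ne hi
  · rw [PowerSeries.coeff_succ_X_mul, PowerSeries.coeff_derivative, artinHasseLog,
      PowerSeries.coeff_mk]
    have : ((n + 1 : ℕ) : Omega p γ) ≠ 0 := Nat.cast_ne_zero.mpr (Nat.succ_ne_zero n)
    split_ifs
    · rw [← Nat.cast_succ, inv_mul_cancel₀ this, mul_one]
    · simp

lemma constantCoeff_theta : PowerSeries.constantCoeff (theta p γ) = 1 := by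
  rw [← PowerSeries.coeff_zero_eq_constantCoeff_apply, theta, PowerSeries.coeff_rescale, pow_zero,
    one_mul, PowerSeries.coeff_zero_eq_constantCoeff_apply, artinHasse]
  change MvPowerSeries.constantCoeff _ = _
  rw [PowerSeries.constantCoeff_subst
    (PowerSeries.HasSubst.of_constantCoeff_zero' coeff_zero_artinHasseLog), finsum_eq_single _ 0]
  · simp
  · intro n hn
    rw [map_pow, show MvPowerSeries.constantCoeff (artinHasseLog p γ) = 0 from coeff_zero_artinHasseLog,
      zero_pow hn, smul_zero]

lemma prime_pow_ne_zero (j : ℕ) : p ^ j ≠ 0 := pow_ne_zero j (Fact.out : p.Prime).ne_zero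

variable (p γ) in
/-- The logarithmic derivative of `splitF j` in the direction `c`. -/
def splitFLog (c : (Fin 2 →₀ ℕ) → ℤ) (j : ℕ) : RelSeries p γ :=
  ((c (Finsupp.single 0 1) : Omega p γ) * (p ^ j : ℕ)) •
      (thetaLog p γ).subst ((MvPowerSeries.X 0 : RelSeries p γ) ^ p ^ j) +
    ((c (Finsupp.single 1 1) : Omega p γ) * (p ^ j : ℕ)) •
      (thetaLog p γ).subst ((MvPowerSeries.X 1 : RelSeries p γ) ^ p ^ j)

lemma euler_splitF {c : (Fin 2 →₀ ℕ) → ℤ} (hc : ∀ d e, c (d + e) = c d + c e) (j : ℕ) :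
    euler p γ c (splitF p γ j) = splitF p γ j * splitFLog p γ c j := by
  have hj := prime_pow_ne_zero (p := p) j
  rw [splitF, euler_mul hc, euler_subst hc 0 hj, euler_subst hc 1 hj, X_mul_derivative_theta,
    PowerSeries.subst_mul (hasSubst_X_pow 0 hj), PowerSeries.subst_mul (hasSubst_X_pow 1 hj),
    splitFLog]
  simp only [MvPowerSeries.smul_eq_C_mul]
  ring

lemma euler_one {c : (Fin 2 →₀ ℕ) → ℤ} (hc : ∀ d e, c (d + e) = c d + c e) :
    euler p γ c 1 = 0 := by
  have := euler_mul (p := p) (γ := γ) hc 1 1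
  simpa using this

lemma euler_prod_splitF {c : (Fin 2 →₀ ℕ) → ℤ} (hc : ∀ d e, c (d + e) = c d + c e) (N : ℕ) :
    euler p γ c (∏ j ∈ Finset.range N, splitF p γ j) =
      (∏ j ∈ Finset.range N, splitF p γ j) * ∑ j ∈ Finset.range N, splitFLog p γ c j := by
  induction N with
  | zero => simpa using euler_one hc
  | succ N ih =>
    rw [Finset.prod_range_succ, Finset.sum_range_succ, euler_mul hc, ih, euler_splitF hc]
    ring

/-- Equality of all coefficients of degree at most `N`. -/
def AgreeUpTo (N : ℕ) (f g : RelSeries p γ) : Prop :=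
  ∀ d : Fin 2 →₀ ℕ, d.degree ≤ N → MvPowerSeries.coeff d f = MvPowerSeries.coeff d g

lemma AgreeUpTo.mul {N : ℕ} {f f' g g' : RelSeries p γ} (hf : AgreeUpTo N f f')
    (hg : AgreeUpTo N g g') : AgreeUpTo N (f * g) (f' * g') := fun d hd => by
  classical
  rw [MvPowerSeries.coeff_mul, MvPowerSeries.coeff_mul]
  refine Finset.sum_congr rfl fun x hx => ?_
  have h : x.1.degree + x.2.degree = d.degree := by
    rw [← map_add, Finset.HasAntidiagonal.mem_antidiagonal.mp hx]
  rw [hf x.1 (by omega), hg x.2 (by omega)]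

lemma AgreeUpTo.euler {N : ℕ} {f g : RelSeries p γ} (h : AgreeUpTo N f g)
    (c : (Fin 2 →₀ ℕ) → ℤ) : AgreeUpTo N (euler p γ c f) (euler p γ c g) := fun d hd => by
  rw [coeff_euler, coeff_euler, h d hd]

lemma agreeUpTo_subst_theta {N j : ℕ} (h : N < p ^ j) (s : Fin 2) :
    AgreeUpTo N ((theta p γ).subst ((MvPowerSeries.X s : RelSeries p γ) ^ p ^ j)) 1 :=
  fun d hd => by
  classical
  rw [coeff_subst_X_pow s (prime_pow_ne_zero j), MvPowerSeries.coeff_one]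
  by_cases h0 : d = 0
  · subst h0
    simp [constantCoeff_theta]
  · rw [if_neg h0, if_neg]
    rintro ⟨h1, h2⟩
    have h3 : d s ≤ d.degree := Finsupp.le_degree s d
    have h4 : d s = 0 := Nat.eq_zero_of_dvd_of_lt h2 (by omega)
    rw [h4, Finsupp.single_zero] at h1
    exact h0 h1

lemma agreeUpTo_splitF {N j : ℕ} (h : N < p ^ j) : AgreeUpTo N (splitF p γ j) 1 := by
  have := (agreeUpTo_subst_theta (γ := γ) h 0).mul (agreeUpTo_subst_theta (γ := γ) h 1)
  rwa [mul_one] at this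

lemma agreeUpTo_prod_splitF {N M : ℕ} (h : N ≤ M) :
    AgreeUpTo N (∏ j ∈ Finset.range (M + 1), splitF p γ j)
      (∏ j ∈ Finset.range (N + 1), splitF p γ j) := by
  induction M, h using Nat.le_induction with
  | base => exact fun _ _ => rfl
  | succ M hM ih =>
    have hlt : N < p ^ (M + 1) := by
      have := Nat.lt_pow_self (Fact.out : p.Prime).one_lt (n := M + 1)
      omega
    have := ih.mul (agreeUpTo_splitF (γ := γ) hlt)
    rwa [mul_one, ← Finset.prod_range_succ] at this

lemma agreeUpTo_splitG (N : ℕ) :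
    AgreeUpTo N (splitG p γ) (∏ j ∈ Finset.range (N + 1), splitF p γ j) := fun d hd =>
  (agreeUpTo_prod_splitF hd d le_rfl).symm

lemma sum_coeff_subst_thetaLog {a N : ℕ} (h : a ≤ N) :
    (∑ j ∈ Finset.range (N + 1), ((p ^ j : ℕ) : Omega p γ) *
      if p ^ j ∣ a then PowerSeries.coeff (a / p ^ j) (thetaLog p γ) else 0) =
      logCoeff p γ a := by
  classical
  have hp := (Fact.out : p.Prime)
  by_cases ha : ∃ l, a = p ^ l
  · obtain ⟨l, rfl⟩ := ha
    have hl : l ≤ N := (Nat.lt_pow_self hp.one_lt).le.trans h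
    rw [logCoeff_pow, ← Finset.sum_subset (Finset.range_mono (Nat.succ_le_succ hl)),
      ← Finset.sum_range_reflect]
    · refine Finset.sum_congr rfl fun j hj => ?_
      have hj' : j ≤ l := Nat.lt_succ_iff.mp (Finset.mem_range.mp hj)
      rw [Nat.succ_sub_one, if_pos (pow_dvd_pow p (Nat.sub_le l j)),
        Nat.pow_div (Nat.sub_le l j) hp.pos, Nat.sub_sub_self hj', thetaLog,
        PowerSeries.coeff_mk, if_pos ⟨j, rfl⟩]
      push_cast
      rfl
    · intro j _ hj
      rw [if_neg, mul_zero]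
      intro hdvd
      have := (Nat.pow_dvd_pow_iff_le_right hp.one_lt).mp hdvd
      simp at hj
      omega
  · rw [logCoeff_of_ne (not_exists.mp ha)]
    refine Finset.sum_eq_zero fun j _ => ?_
    split_ifs with hdvd
    · rw [thetaLog, PowerSeries.coeff_mk, if_neg, mul_zero]
      rintro ⟨i, hi⟩
      refine ha ⟨j + i, ?_⟩
      rw [pow_add, ← hi, Nat.mul_div_cancel' hdvd]
    · rw [mul_zero]

lemma sum_coeff_smul_subst_thetaLog (s : Fin 2) {d : Fin 2 →₀ ℕ} {N : ℕ} (hd : d.degree ≤ N)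
    (e : Omega p γ) :
    MvPowerSeries.coeff d (∑ j ∈ Finset.range (N + 1), (e * (p ^ j : ℕ)) •
      (thetaLog p γ).subst ((MvPowerSeries.X s : RelSeries p γ) ^ p ^ j)) =
      e * if d = Finsupp.single s (d s) then logCoeff p γ (d s) else 0 := by
  rw [map_sum]
  simp only [MvPowerSeries.coeff_smul, coeff_subst_X_pow s (prime_pow_ne_zero _), mul_assoc]
  rw [← Finset.mul_sum]
  congr 1
  by_cases h : d = Finsupp.single s (d s)
  · rw [if_pos h, ← sum_coeff_subst_thetaLog ((Finsupp.le_degree s d).trans hd)]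
    simp only [and_iff_right h]
  · rw [if_neg h]
    refine Finset.sum_eq_zero fun j _ => ?_
    rw [if_neg fun h' => h h'.1, mul_zero]

variable (p γ) in
/-- The logarithmic derivative of `G` in the direction `c`. -/
def splitGLog (c : (Fin 2 →₀ ℕ) → ℤ) : RelSeries p γ :=
  (c (Finsupp.single 0 1) : Omega p γ) • logX p γ + (c (Finsupp.single 1 1) : Omega p γ) • logY p γ

lemma agreeUpTo_sum_splitFLog (c : (Fin 2 →₀ ℕ) → ℤ) (N : ℕ) :
    AgreeUpTo N (∑ j ∈ Finset.range (N + 1), splitFLog p γ c j) (splitGLog p γ c) := by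
  intro d hd
  have h0 : d = Finsupp.single 0 (d 0) ↔ d 1 = 0 := by
    rw [Finsupp.ext_iff, Fin.forall_fin_two]
    simp
  have h1 : d = Finsupp.single 1 (d 1) ↔ d 0 = 0 := by
    rw [Finsupp.ext_iff, Fin.forall_fin_two]
    simp
  simp only [splitFLog]
  rw [Finset.sum_add_distrib, map_add, sum_coeff_smul_subst_thetaLog 0 hd,
    sum_coeff_smul_subst_thetaLog 1 hd, splitGLog, map_add, MvPowerSeries.coeff_smul,
    MvPowerSeries.coeff_smul]
  simp only [h0, h1]
  rfl

lemma euler_splitG {c : (Fin 2 →₀ ℕ) → ℤ} (hc : ∀ d e, c (d + e) = c d + c e) :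
    euler p γ c (splitG p γ) = splitG p γ * splitGLog p γ c := by
  refine MvPowerSeries.ext fun d => ?_
  have h1 := (agreeUpTo_splitG (p := p) (γ := γ) d.degree).euler c d le_rfl
  rw [h1, euler_prod_splitF hc]
  have h2 := (agreeUpTo_splitG (p := p) (γ := γ) d.degree).mul
    fun e he => (agreeUpTo_sum_splitFLog c d.degree e he).symm
  exact (h2 d le_rfl).symm

lemma constantCoeff_splitG : MvPowerSeries.constantCoeff (splitG p γ) = 1 := by
  have h1 := agreeUpTo_splitG (p := p) (γ := γ) 0 0 (by simp)
  have h2 := agreeUpTo_splitF (p := p) (γ := γ) (N := 0) (j := 0) (by simp) 0 (by simp)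
  rw [zero_add, Finset.prod_range_one, h2] at h1
  simpa using h1

lemma twist_euler {c : (Fin 2 →₀ ℕ) → ℤ} (hc : ∀ d e, c (d + e) = c d + c e)
    (f : RelSeries p γ) :
    twist p γ (euler p γ c) f = splitGLog p γ c * f + euler p γ c f := by
  change (splitG p γ)⁻¹ * euler p γ c (splitG p γ * f) = _
  have h : (splitG p γ)⁻¹ * splitG p γ = 1 := MvPowerSeries.inv_mul_cancel _ (by
    rw [constantCoeff_splitG]
    exact one_ne_zero)
  rw [euler_mul hc, euler_splitG hc]
  linear_combination (splitGLog p γ c * f + euler p γ c f) * h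

lemma hatD_eq (f : RelSeries p γ) :
    hatD p γ f = (logX p γ - logY p γ) * f + xDx p γ f := by
  rw [hatD, xDx, twist_euler]
  · congr 2
    simp [splitGLog, sub_eq_add_neg]
  · intro d e
    simp only [Finsupp.add_apply]
    push_cast
    ring

lemma hatPartial_eq (f : RelSeries p γ) :
    hatPartial p γ f = logY p γ * f + tDt p γ f := by
  rw [hatPartial, tDt, twist_euler]
  · congr 2
    simp [splitGLog]
  · intro d e
    simp only [Finsupp.add_apply]
    push_cast
    ring

end LogDerivative

/-! ### The Gauss–Manin matrix -/

section GaussManin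

/-- The combination `M₀ + M₁ γ y` of the basis elements. -/
def relComb (M : Fin 2 → (Omega p γ)⟦X⟧) : RelSeries p γ :=
  ∑ j, ofT p γ (M j) * relBasis p γ j

/-- The sum of the coefficients of the homogeneous part of degree `d`. -/
def degreeSum (d : ℕ) (f : RelSeries p γ) : Omega p γ :=
  ∑ i ∈ Finset.range (d + 1), MvPowerSeries.coeff (relMon i (d - i)) f

/-- The series `∑ (φ(2n + 1) / γ) t^n`, with `φ` the coefficients of `logX`. -/
def leadUnit : (Omega p γ)⟦X⟧ :=
  PowerSeries.mk fun n => (gam p γ)⁻¹ * logCoeff p γ (2 * n + 1)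

/-- The leading part of the Gauss–Manin matrix. -/
def leadMatrix : Matrix (Fin 2) (Fin 2) (Omega p γ)⟦X⟧ :=
  !![0, leadUnit p γ; gam p γ ^ 2 • (X * leadUnit p γ), 0]

variable {p γ}

lemma coeff_ofT (f : (Omega p γ)⟦X⟧) (i j : ℕ) :
    MvPowerSeries.coeff (relMon i j) (ofT p γ f) = if i = j then PowerSeries.coeff i f else 0 := by
  change (if _ then _ else _) = _
  simp

lemma coeff_relComb (M : Fin 2 → (Omega p γ)⟦X⟧) (i j : ℕ) :
    MvPowerSeries.coeff (relMon i j) (relComb p γ M) =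
      if j = i then PowerSeries.coeff i (M 0)
      else if j = i + 1 then gam p γ * PowerSeries.coeff i (M 1) else 0 := by
  have h : relComb p γ M = ofT p γ (M 0) +
      MvPowerSeries.C (gam p γ) * (MvPowerSeries.X 1 * ofT p γ (M 1)) := by
    rw [relComb, Fin.sum_univ_two]
    simp only [relBasis, Matrix.cons_val_zero, Matrix.cons_val_one]
    ring
  rw [h, map_add, MvPowerSeries.coeff_C_mul, coeff_ofT]
  rcases j with _ | j
  · rw [coeff_X_mul_eq_zero _ (relMon_one _ _)]
    rcases i with _ | i <;> simp
  · rw [coeff_X_one_mul, coeff_ofT]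
    by_cases h1 : i = j + 1
    · simp [h1]
    · by_cases h2 : i = j
      · simp [h2]
      · simp [h1, h2, Ne.symm h1, Ne.symm h2]

lemma relComb_sub (M N : Fin 2 → (Omega p γ)⟦X⟧) :
    relComb p γ (M - N) = relComb p γ M - relComb p γ N := by
  refine MvPowerSeries.ext fun d => ?_
  rw [← relMon_self d, map_sub, coeff_relComb, coeff_relComb, coeff_relComb]
  split_ifs <;> simp [mul_sub]

lemma relComb_mem_vanishing (M : Fin 2 → (Omega p γ)⟦X⟧) :
    relComb p γ M ∈ vanishing p γ offDiagonal := by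
  rintro d ⟨h1, h2⟩
  change MvPowerSeries.coeff d (relComb p γ M) = 0
  rw [← relMon_self d, coeff_relComb, if_neg h1, if_neg h2]

lemma relComb_injective (hγ : IsSplittingRoot p γ) : Function.Injective (relComb p γ) := by
  intro M N h
  have h0 (n : ℕ) := congrArg (MvPowerSeries.coeff (relMon n n)) h
  have h1 (n : ℕ) := congrArg (MvPowerSeries.coeff (relMon n (n + 1))) h
  simp only [coeff_relComb, if_true] at h0 h1
  simp only [Nat.succ_ne_self, if_false] at h1
  funext j
  fin_cases j
  · exact PowerSeries.ext h0
  · exact PowerSeries.ext fun n => mul_left_cancel₀ (gam_ne_zero hγ) (h1 n)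

lemma exists_relComb_eq (hγ : IsSplittingRoot p γ) {v : RelSeries p γ}
    (hv : v ∈ vanishing p γ offDiagonal) : ∃ M, v = relComb p γ M := by
  refine ⟨![PowerSeries.mk fun n => MvPowerSeries.coeff (relMon n n) v,
    PowerSeries.mk fun n => (gam p γ)⁻¹ * MvPowerSeries.coeff (relMon n (n + 1)) v],
    MvPowerSeries.ext fun d => ?_⟩
  have hd := hv d
  rw [← relMon_self d, coeff_relComb]
  split_ifs with h1 h2
  · simp [h1]
  · simp [h2, gam_ne_zero hγ]
  · rw [relMon_self]
    exact hd ⟨h1, h2⟩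

lemma mem_of_relComb_mem (hγ : IsSplittingRoot p γ) {b b' ρ : ℝ} {M : Fin 2 → (Omega p γ)⟦X⟧}
    (h : relComb p γ M ∈ growthAt p γ (weightK b' b) ρ) :
    M 0 ∈ spaceLAt p γ b' ρ ∧ M 1 ∈ spaceLAt p γ b' (ρ + (b - 1 / ((p : ℝ) - 1))) := by
  have h' (i j : ℕ) : OrdGE p (MvPowerSeries.coeff (relMon i j) (relComb p γ M))
    (weightK b' b (relMon i j) + ρ) := h _
  constructor
  · intro n
    have := h' n n
    rw [coeff_relComb, if_pos rfl, weightK_of_le le_rfl] at this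
    refine ordGE_mono p γ ?_ this
    linarith
  · intro n
    have := h' n (n + 1)
    rw [coeff_relComb, if_neg (by omega), if_pos rfl, weightK_of_le (by omega)] at this
    have h2 := ordGE_mul p γ (ordGE_inv_gam hγ) this
    rw [inv_mul_cancel_left₀ (gam_ne_zero hγ)] at h2
    refine ordGE_mono p γ ?_ h2
    push_cast
    linarith

lemma degreeSum_sub (d : ℕ) (f g : RelSeries p γ) :
    degreeSum p γ d (f - g) = degreeSum p γ d f - degreeSum p γ d g := by
  simp [degreeSum, Finset.sum_sub_distrib]

lemma degreeSum_C_mul (d : ℕ) (a : Omega p γ) (f : RelSeries p γ) :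
    degreeSum p γ d (MvPowerSeries.C a * f) = a * degreeSum p γ d f := by
  simp [degreeSum, MvPowerSeries.coeff_C_mul, Finset.mul_sum]

lemma degreeSum_zero_X_mul (s : Fin 2) (f : RelSeries p γ) :
    degreeSum p γ 0 (MvPowerSeries.X s * f) = 0 := by
  rw [degreeSum, zero_add, Finset.sum_range_one, coeff_X_mul_eq_zero]
  fin_cases s <;> simp

lemma degreeSum_succ_X_zero_mul (d : ℕ) (f : RelSeries p γ) :
    degreeSum p γ (d + 1) (MvPowerSeries.X 0 * f) = degreeSum p γ d f := by
  rw [degreeSum, Finset.sum_range_succ', coeff_X_mul_eq_zero _ (relMon_zero _ _), add_zero]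
  refine Finset.sum_congr rfl fun i _ => ?_
  rw [coeff_X_zero_mul, Nat.add_sub_add_right]

lemma degreeSum_succ_X_one_mul (d : ℕ) (f : RelSeries p γ) :
    degreeSum p γ (d + 1) (MvPowerSeries.X 1 * f) = degreeSum p γ d f := by
  rw [degreeSum, Finset.sum_range_succ, Nat.sub_self, coeff_X_mul_eq_zero _ (relMon_one _ _),
    add_zero]
  refine Finset.sum_congr rfl fun i hi => ?_
  rw [Nat.succ_sub (Nat.lt_succ_iff.mp (Finset.mem_range.mp hi)), coeff_X_one_mul]

lemma degreeSum_X_sub_mul (d : ℕ) (f : RelSeries p γ) :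
    degreeSum p γ d ((MvPowerSeries.X 0 - MvPowerSeries.X 1) * f) = 0 := by
  rw [sub_mul, degreeSum_sub]
  rcases d with _ | d
  · rw [degreeSum_zero_X_mul, degreeSum_zero_X_mul, sub_zero]
  · rw [degreeSum_succ_X_zero_mul, degreeSum_succ_X_one_mul, sub_self]

lemma degreeSum_logY (d : ℕ) : degreeSum p γ d (logY p γ) = logCoeff p γ d := by
  rw [degreeSum, Finset.sum_range_succ', coeff_logY, if_pos rfl]
  simp [coeff_logY]

lemma degreeSum_even_relComb (n : ℕ) (M : Fin 2 → (Omega p γ)⟦X⟧) :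
    degreeSum p γ (2 * n) (relComb p γ M) = PowerSeries.coeff n (M 0) := by
  rw [degreeSum, Finset.sum_eq_single_of_mem n (by simp; omega), coeff_relComb, if_pos (by omega)]
  intro i hi hne
  have := Finset.mem_range.mp hi
  rw [coeff_relComb, if_neg (by omega), if_neg (by omega)]

lemma degreeSum_odd_relComb (n : ℕ) (M : Fin 2 → (Omega p γ)⟦X⟧) :
    degreeSum p γ (2 * n + 1) (relComb p γ M) = gam p γ * PowerSeries.coeff n (M 1) := by
  rw [degreeSum, Finset.sum_eq_single_of_mem n (by simp; omega), coeff_relComb, if_neg (by omega),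
    if_pos (by omega)]
  intro i hi hne
  have := Finset.mem_range.mp hi
  rw [coeff_relComb, if_neg (by omega), if_neg (by omega)]

/-- The remainder of a division by the leading operator is determined by the sums of the
coefficients of the homogeneous parts. -/
lemma sub_relLead_eq_relComb (hγ : IsSplittingRoot p γ) {v k : RelSeries p γ}
    {M : Fin 2 → (Omega p γ)⟦X⟧}
    (hk : v - (logX p γ - logY p γ) * k ∈ vanishing p γ offDiagonal)
    (h0 : ∀ n, degreeSum p γ (2 * n) v = PowerSeries.coeff n (M 0))
    (h1 : ∀ n, degreeSum p γ (2 * n + 1) v = gam p γ * PowerSeries.coeff n (M 1)) :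
    v - (logX p γ - logY p γ) * k = relComb p γ M := by
  obtain ⟨N, hN⟩ := exists_relComb_eq hγ hk
  have hs (d : ℕ) : degreeSum p γ d (relComb p γ N) = degreeSum p γ d v := by
    rw [← hN, degreeSum_sub, logX_sub_logY hγ, mul_assoc, mul_assoc, degreeSum_C_mul,
      degreeSum_X_sub_mul, mul_zero, sub_zero]
  rw [hN]
  congr 1
  funext j
  fin_cases j
  · refine PowerSeries.ext fun n => ?_
    exact (degreeSum_even_relComb n N).symm.trans ((hs _).trans (h0 n))
  · refine PowerSeries.ext fun n => mul_left_cancel₀ (gam_ne_zero hγ) ?_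
    exact (degreeSum_odd_relComb n N).symm.trans ((hs _).trans (h1 n))

variable {b b' : ℝ}

lemma leadUnit_mem (hγ : IsSplittingRoot p γ) (hb : b ≤ (p : ℝ) / ((p : ℝ) - 1)) (hb' : b' ≤ b) :
    leadUnit p γ ∈ spaceLAt p γ b' 0 := fun n => by
  change OrdGE p (PowerSeries.coeff n (leadUnit p γ)) _
  rw [leadUnit, PowerSeries.coeff_mk]
  refine ordGE_mul_of_le (ordGE_inv_gam hγ) (ordGE_logCoeff hγ hb _) ?_
  have := mul_le_mul_of_nonneg_right hb' (Nat.cast_nonneg (α := ℝ) n)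
  push_cast
  linarith

lemma constantCoeff_leadUnit (hγ : IsSplittingRoot p γ) :
    PowerSeries.constantCoeff (leadUnit p γ) = 1 := by
  rw [← PowerSeries.coeff_zero_eq_constantCoeff_apply, leadUnit, PowerSeries.coeff_mk]
  simp [gam_ne_zero hγ]

lemma gam_sq_smul_X_mul_mem (hγ : IsSplittingRoot p γ) (hb' : b' ≤ b) {r : ℝ}
    {f : (Omega p γ)⟦X⟧} (hf : f ∈ spaceLAt p γ b' r) :
    gam p γ ^ 2 • (X * f) ∈ spaceLAt p γ b' (r - 2 * (b - 1 / ((p : ℝ) - 1))) := fun n => by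
  change OrdGE p (PowerSeries.coeff n (gam p γ ^ 2 • (X * f))) _
  rw [PowerSeries.coeff_smul, smul_eq_mul]
  rcases n with _ | n
  · rw [PowerSeries.coeff_zero_X_mul, mul_zero]
    exact ordGE_zero p γ _
  · rw [PowerSeries.coeff_succ_X_mul, pow_two]
    refine ordGE_mul_of_le (ordGE_mul p γ (ordGE_gam hγ) (ordGE_gam hγ)) (hf n) ?_
    push_cast
    linarith

/-- The Gauss–Manin matrix agrees to first order with its leading part. -/
structure IsNearLead (b' ε : ℝ) (H : Matrix (Fin 2) (Fin 2) (Omega p γ)⟦X⟧) : Prop where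
  mem_zero_zero : H 0 0 ∈ spaceLAt p γ b' 0
  mem_zero_one : H 0 1 - leadMatrix p γ 0 1 ∈ spaceLAt p γ b' ε
  mem_one_zero : H 1 0 - leadMatrix p γ 1 0 ∈ spaceLAt p γ b' (-ε)
  mem_one_one : H 1 1 ∈ spaceLAt p γ b' 0

lemma relBasis_one_mem (hγ : IsSplittingRoot p γ) :
    relBasis p γ 1 ∈ growthAt p γ (weightK b' b) (-(b - 1 / ((p : ℝ) - 1))) := fun d => by
  classical
  change OrdGE p (MvPowerSeries.coeff d (MvPowerSeries.C (gam p γ) * MvPowerSeries.X 1)) _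
  rw [MvPowerSeries.coeff_C_mul, MvPowerSeries.coeff_X]
  split_ifs with h
  · rw [mul_one, h]
    refine ordGE_mono p γ ?_ (ordGE_gam hγ)
    have : (Finsupp.single 1 1 : Fin 2 →₀ ℕ) = relMon 0 1 := by simp [relMon]
    rw [this, weightK_of_le (by omega)]
    push_cast
    linarith
  · rw [mul_zero]
    exact ordGE_zero p γ _

lemma hatD_eq_relLead_add (k : RelSeries p γ) :
    hatD p γ k = (relLead p γ + relPert p γ) k := hatD_eq k

/-- Reduction of an element of `𝒦(b', b)` to the basis, with the leading part of the result. -/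
lemma exists_relComb_congr (hγ : IsSplittingRoot p γ) (hb0 : 1 / ((p : ℝ) - 1) < b)
    (hb : b ≤ (p : ℝ) / ((p : ℝ) - 1)) (hb' : b' ≤ b) {ρ : ℝ} {v : RelSeries p γ}
    (hv : v ∈ growthAt p γ (weightK b' b) ρ) {M₀ : Fin 2 → (Omega p γ)⟦X⟧}
    (h0 : ∀ n, degreeSum p γ (2 * n) v = PowerSeries.coeff n (M₀ 0))
    (h1 : ∀ n, degreeSum p γ (2 * n + 1) v = gam p γ * PowerSeries.coeff n (M₀ 1)) :
    ∃ M, v - relComb p γ M ∈ (spaceK p γ b' b).map (hatD p γ) ∧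
      M 0 - M₀ 0 ∈ spaceLAt p γ b' (ρ + (b - 1 / ((p : ℝ) - 1))) ∧
      M 1 - M₀ 1 ∈ spaceLAt p γ b' (ρ + 2 * (b - 1 / ((p : ℝ) - 1))) := by
  have hdiv := isDivision_rel hγ hb0 hb hb'
  obtain ⟨k₀, -, hk₀⟩ := hdiv.exists_quot ρ v hv
  obtain ⟨k, hk, hkr, hd⟩ := hdiv.exists_add_quot hv hk₀
  obtain ⟨M, hM⟩ := exists_relComb_eq hγ hkr
  have hd' : relComb p γ (M - M₀) ∈
      growthAt p γ (weightK b' b) (ρ + (b - 1 / ((p : ℝ) - 1))) := by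
    rw [relComb_sub, ← hM, ← sub_relLead_eq_relComb hγ hk₀ h0 h1]
    exact hd
  obtain ⟨hm0, hm1⟩ := mem_of_relComb_mem hγ hd'
  refine ⟨M, ⟨k, mem_spaceK.mpr ⟨_, hk⟩, ?_⟩, hm0, ?_⟩
  · rw [← hM]
    exact (hatD_eq_relLead_add k).trans (sub_sub_cancel v _).symm
  · rw [two_mul, ← add_assoc]
    exact hm1

lemma tDt_relBasis_one : tDt p γ (relBasis p γ 1) = relBasis p γ 1 := by
  classical
  refine MvPowerSeries.ext fun d => ?_
  rw [tDt, coeff_euler]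
  change _ * MvPowerSeries.coeff d (MvPowerSeries.C (gam p γ) * MvPowerSeries.X 1) =
    MvPowerSeries.coeff d (MvPowerSeries.C (gam p γ) * MvPowerSeries.X 1)
  rw [MvPowerSeries.coeff_C_mul, MvPowerSeries.coeff_X]
  split_ifs with h
  · rw [h]
    simp
  · simp

lemma tDt_relBasis_zero : tDt p γ (relBasis p γ 0) = 0 :=
  euler_one fun d e => by simp

lemma relComb_zero_one : relComb p γ ![0, 1] = relBasis p γ 1 := by
  have h0 : ofT p γ 0 = 0 := MvPowerSeries.ext fun d => by
    rw [← relMon_self d, coeff_ofT]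
    simp
  have h1 : ofT p γ 1 = 1 := by
    refine MvPowerSeries.ext fun d => ?_
    classical
    rw [← relMon_self d, coeff_ofT, MvPowerSeries.coeff_one, PowerSeries.coeff_one]
    have : relMon (d 0) (d 1) = 0 ↔ d 0 = 0 ∧ d 1 = 0 := by
      rw [relMon_self, Finsupp.ext_iff, Fin.forall_fin_two]
      simp
    simp only [this]
    split_ifs <;> first | rfl | omega
  rw [relComb, Fin.sum_univ_two]
  simp [h0, h1]

lemma exists_isGaussManinMatrix (hp : 5 ≤ p) (hγ : IsSplittingRoot p γ)
    (hb0 : 1 / ((p : ℝ) - 1) < b) (hb : b ≤ (p : ℝ) / ((p : ℝ) - 1)) (hb' : b' ≤ b) :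
    ∃ H, IsGaussManinMatrix p γ b' b H ∧ IsNearLead b' (b - 1 / ((p : ℝ) - 1)) H := by
  have hg := gam_ne_zero hγ
  obtain ⟨M, hMc, hM0, hM1⟩ := exists_relComb_congr hγ hb0 hb hb' (logY_mem hγ hb hb')
    (M₀ := ![0, leadUnit p γ])
    (fun n => by simp [degreeSum_logY, logCoeff_even hp])
    (fun n => by simp [degreeSum_logY, leadUnit, hg])
  have hv : logY p γ * relBasis p γ 1 = MvPowerSeries.C (gam p γ) *
      (MvPowerSeries.X 1 * logY p γ) := by
    change _ * (MvPowerSeries.C (gam p γ) * MvPowerSeries.X 1) = _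
    ring
  obtain ⟨N, hNc, hN0, hN1⟩ := exists_relComb_congr hγ hb0 hb hb'
    (mul_mem_growthAt (weightK_add hb') (logY_mem hγ hb hb') (relBasis_one_mem hγ))
    (M₀ := ![gam p γ ^ 2 • (X * leadUnit p γ), 0])
    (fun n => by
      rw [hv, degreeSum_C_mul, Matrix.cons_val_zero, PowerSeries.coeff_smul]
      rcases n with _ | n
      · rw [mul_zero, degreeSum_zero_X_mul, PowerSeries.coeff_zero_X_mul, mul_zero, smul_zero]
      · rw [PowerSeries.coeff_succ_X_mul, show 2 * (n + 1) = 2 * n + 1 + 1 by ring,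
          degreeSum_succ_X_one_mul, degreeSum_logY, leadUnit, PowerSeries.coeff_mk, smul_eq_mul,
          pow_two, mul_assoc, mul_inv_cancel_left₀ hg])
    (fun n => by
      rw [hv, degreeSum_C_mul, degreeSum_succ_X_one_mul, degreeSum_logY, logCoeff_even hp]
      simp)
  have hnear : IsNearLead b' (b - 1 / ((p : ℝ) - 1)) (p := p) (γ := γ)
      !![M 0, M 1; N 0, N 1 + 1] := by
    refine ⟨?_, ?_, ?_, ?_⟩
    · simpa using hM0
    · refine spaceLAt_mono ?_ hM1
      linarith
    · refine spaceLAt_mono ?_ hN0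
      linarith
    · refine add_mem (spaceLAt_mono ?_ (by simpa using hN1)) fun n => ?_
      · linarith
      · change OrdGE p (PowerSeries.coeff n 1) _
        rw [PowerSeries.coeff_one]
        split_ifs with h
        · rw [h]
          simpa using ordGE_one
        · exact ordGE_zero p γ _
  refine ⟨_, ⟨fun i j => ?_, fun i => ?_⟩, hnear⟩
  · rw [mem_spaceL]
    have hu := leadUnit_mem hγ hb hb'
    have hX := gam_sq_smul_X_mul_mem hγ hb' hu
    fin_cases i <;> fin_cases j
    · exact ⟨_, hnear.mem_zero_zero⟩
    · have := (spaceL p γ b').add_mem (mem_spaceL.mpr ⟨_, hnear.mem_zero_one⟩)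
        (mem_spaceL.mpr ⟨_, hu⟩)
      rw [show leadUnit p γ = leadMatrix p γ 0 1 from rfl, sub_add_cancel] at this
      exact this
    · have := (spaceL p γ b').add_mem (mem_spaceL.mpr ⟨_, hnear.mem_one_zero⟩)
        (mem_spaceL.mpr ⟨_, hX⟩)
      rw [show gam p γ ^ 2 • (X * leadUnit p γ) = leadMatrix p γ 1 0 from rfl,
        sub_add_cancel] at this
      exact this
    · exact ⟨_, hnear.mem_one_one⟩
  · rw [hatPartial_eq]
    fin_cases i
    · convert hMc using 2
      · change logY p γ * relBasis p γ 0 + tDt p γ (relBasis p γ 0) = _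
        rw [tDt_relBasis_zero, add_zero]
        exact mul_one _
      · rw [relComb, Fin.sum_univ_two, Fin.sum_univ_two]
        rfl
    · have h1 : (∑ j, ofT p γ (!![M 0, M 1; N 0, N 1 + 1] 1 j) * relBasis p γ j) =
          relComb p γ N + relBasis p γ 1 := by
        have h2 : relComb p γ (!![M 0, M 1; N 0, N 1 + 1] 1) - relComb p γ ![0, 1] =
            relComb p γ N := by
          rw [← relComb_sub]
          congr 1
          funext j
          fin_cases j <;> simp
        rw [← h2, relComb_zero_one, sub_add_cancel]
        rfl
      change logY p γ * relBasis p γ 1 + tDt p γ (relBasis p γ 1) -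
        (∑ j, ofT p γ (!![M 0, M 1; N 0, N 1 + 1] 1 j) * relBasis p γ j) ∈ _
      rw [h1, tDt_relBasis_one, add_sub_add_right_eq_sub]
      exact hNc

lemma IsGaussManinMatrix.eq (hγ : IsSplittingRoot p γ) (hb0 : 1 / ((p : ℝ) - 1) < b)
    (hb : b ≤ (p : ℝ) / ((p : ℝ) - 1)) (hb' : b' ≤ b)
    {H H' : Matrix (Fin 2) (Fin 2) (Omega p γ)⟦X⟧} (h : IsGaussManinMatrix p γ b' b H)
    (h' : IsGaussManinMatrix p γ b' b H') : H = H' := by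
  funext i
  have h1 := sub_mem (h'.congr i) (h.congr i)
  rw [sub_sub_sub_cancel_left] at h1
  obtain ⟨k, hk, hkD⟩ := h1
  obtain ⟨ρ, hk⟩ := mem_spaceK.mp hk
  have hkD' : hatD p γ k = relComb p γ (H i - H' i) := by
    rw [relComb_sub]
    exact hkD
  have hk0 : k = 0 := (isDivision_rel hγ hb0 hb hb').eq_zero_of_add_mem hk (by
    have := relComb_mem_vanishing (H i - H' i)
    rwa [← hkD', hatD_eq_relLead_add] at this)
  rw [hk0, map_zero, relComb_sub, eq_comm, sub_eq_zero] at hkD'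
  exact relComb_injective hγ hkD'

end GaussManin

/-! ### The infinite symmetric power in coordinates -/

section SymCoordinates

variable {p γ}

/-- The coefficient of `w^((m))` in the series with coordinates `A`. -/
def wCoeff (A : ℕ × ℕ → Omega p γ) (m : ℕ) : (Omega p γ)⟦X⟧ := PowerSeries.mk fun n => A (n, m)

@[simp] lemma coeff_wCoeff (A : ℕ × ℕ → Omega p γ) (n m : ℕ) :
    PowerSeries.coeff n (wCoeff A m) = A (n, m) := PowerSeries.coeff_mk _ _

lemma wCoeff_add (A B : ℕ × ℕ → Omega p γ) (m : ℕ) :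
    wCoeff (A + B) m = wCoeff A m + wCoeff B m := PowerSeries.ext fun n => by simp

lemma mem_growthAt_iff_wCoeff {b' ε ρ : ℝ} {A : ℕ × ℕ → Omega p γ} :
    A ∈ growthAt p γ (fun i : ℕ × ℕ => 2 * b' * i.1 + ε * i.2) ρ ↔
      ∀ m : ℕ, wCoeff A m ∈ spaceLAt p γ b' (ε * m + ρ) := by
  constructor
  · intro h m n
    change OrdGE p (PowerSeries.coeff n (wCoeff A m)) _
    rw [coeff_wCoeff, ← add_assoc]
    exact h (n, m)
  · rintro h ⟨n, m⟩
    have := mem_spaceLAt.mp (h m) n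
    rw [coeff_wCoeff, ← add_assoc] at this
    exact this

/-- The coefficient of `w^((m))` in `ℒ_{κ, M}` applied to `∑ a(m) w^((m))`. -/
def symPart (κ : ℤ_[p]) (M : Matrix (Fin 2) (Fin 2) (Omega p γ)⟦X⟧) (a : ℕ → (Omega p γ)⟦X⟧)
    (m : ℕ) : (Omega p γ)⟦X⟧ :=
  ofPadicInt p γ (κ - m) • (M 0 0 * a m) + (m : Omega p γ) • (M 1 1 * a m) +
    (if m = 0 then 0 else M 0 1 * a (m - 1)) +
    ofPadicInt p γ (((m + 1 : ℕ) : ℤ_[p]) * (κ - m)) • (M 1 0 * a (m + 1))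

/-- The operator `ℒ_{κ, M}` in the coordinates `A(n, m)`. -/
def symOp (κ : ℤ_[p]) (M : Matrix (Fin 2) (Fin 2) (Omega p γ)⟦X⟧) :
    (ℕ × ℕ → Omega p γ) →+ (ℕ × ℕ → Omega p γ) where
  toFun A := fun i => PowerSeries.coeff i.1 (symPart κ M (wCoeff A) i.2)
  map_zero' := by
    have h (m : ℕ) : wCoeff (0 : ℕ × ℕ → Omega p γ) m = 0 := PowerSeries.ext fun n => by simp
    funext i
    simp [symPart, h]
  map_add' A B := by
    funext i
    rw [Pi.add_apply, ← map_add]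
    congr 1
    simp only [symPart, wCoeff_add, mul_add, smul_add]
    split_ifs <;> abel

lemma wCoeff_symOp (κ : ℤ_[p]) (M : Matrix (Fin 2) (Fin 2) (Omega p γ)⟦X⟧)
    (A : ℕ × ℕ → Omega p γ) (m : ℕ) :
    wCoeff (symOp κ M A) m = symPart κ M (wCoeff A) m :=
  PowerSeries.ext fun _ => coeff_wCoeff _ _ _

lemma symOp_sub (κ : ℤ_[p]) (M N : Matrix (Fin 2) (Fin 2) (Omega p γ)⟦X⟧) :
    symOp κ (M - N) = symOp κ M - symOp κ N := by
  refine AddMonoidHom.ext fun A => funext fun i => ?_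
  rw [AddMonoidHom.sub_apply, Pi.sub_apply]
  change PowerSeries.coeff i.1 (symPart κ (M - N) (wCoeff A) i.2) =
    PowerSeries.coeff i.1 (symPart κ M (wCoeff A) i.2) -
      PowerSeries.coeff i.1 (symPart κ N (wCoeff A) i.2)
  rw [← map_sub]
  congr 1
  simp only [symPart, Matrix.sub_apply, sub_mul, smul_sub]
  split_ifs <;> abel

variable (p γ) in
/-- The operator `t d/dt` in the coordinates `A(n, m)`. -/
def symEuler : (ℕ × ℕ → Omega p γ) →+ (ℕ × ℕ → Omega p γ) where
  toFun A := fun i => (i.1 : Omega p γ) * A i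
  map_zero' := by
    funext i
    simp
  map_add' A B := by
    funext i
    simp [mul_add]

lemma symEuler_mem {wt : ℕ × ℕ → ℝ} {ρ : ℝ} {A : ℕ × ℕ → Omega p γ}
    (hA : A ∈ growthAt p γ wt ρ) : symEuler p γ A ∈ growthAt p γ wt ρ := fun i =>
  ordGE_mul_of_le (ordGE_natCast i.1) (hA i) (by linarith)

lemma symOp_mem {κ : ℤ_[p]} {M : Matrix (Fin 2) (Fin 2) (Omega p γ)⟦X⟧} {b' ε s σ : ℝ}
    (h00 : M 0 0 ∈ spaceLAt p γ b' s) (h01 : M 0 1 ∈ spaceLAt p γ b' (s + ε))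
    (h10 : M 1 0 ∈ spaceLAt p γ b' (s - ε)) (h11 : M 1 1 ∈ spaceLAt p γ b' s)
    {A : ℕ × ℕ → Omega p γ}
    (hA : A ∈ growthAt p γ (fun i : ℕ × ℕ => 2 * b' * i.1 + ε * i.2) σ) :
    symOp κ M A ∈ growthAt p γ (fun i : ℕ × ℕ => 2 * b' * i.1 + ε * i.2) (σ + s) := by
  rw [mem_growthAt_iff_wCoeff] at hA ⊢
  intro m
  rw [wCoeff_symOp, symPart]
  refine add_mem (add_mem (add_mem ?_ ?_) ?_) ?_
  · refine smul_mem_spaceLAt (ordGE_ofPadicInt _)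
      (spaceLAt_mono ?_ (mul_mem_spaceLAt h00 (hA m)))
    linarith
  · refine smul_mem_spaceLAt (ordGE_natCast _) (spaceLAt_mono ?_ (mul_mem_spaceLAt h11 (hA m)))
    linarith
  · split_ifs with hm
    · exact zero_mem _
    · obtain ⟨m, rfl⟩ := Nat.exists_eq_succ_of_ne_zero hm
      refine spaceLAt_mono ?_ (mul_mem_spaceLAt h01 (hA _))
      rw [Nat.succ_sub_one]
      push_cast
      linarith
  · refine smul_mem_spaceLAt (ordGE_ofPadicInt _)
      (spaceLAt_mono ?_ (mul_mem_spaceLAt h10 (hA _)))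
    push_cast
    linarith

lemma fallingFactorial_succ (κ : ℤ_[p]) (m : ℕ) :
    fallingFactorial p γ κ (m + 1) = fallingFactorial p γ κ m * ofPadicInt p γ (κ - m) := by
  rw [fallingFactorial, Finset.prod_range_succ, ofPadicInt_mul]
  rfl

lemma fallingFactorial_ne_zero {κ : ℤ_[p]} (hκ : ∀ k : ℕ, κ ≠ (k : ℤ_[p])) (m : ℕ) :
    fallingFactorial p γ κ m ≠ 0 := by
  have h0 : ofPadicInt p γ 0 = 0 := by simp [ofPadicInt]
  rw [fallingFactorial, ← h0]
  refine fun h => ?_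
  have := ofPadicInt_injective h
  obtain ⟨i, -, hi⟩ := Finset.prod_eq_zero_iff.mp this
  exact hκ i (sub_eq_zero.mp hi)

lemma coeff_symSeries (κ : ℤ_[p]) (A : ℕ × ℕ → Omega p γ) (m : ℕ) :
    PowerSeries.coeff m (symSeries p γ κ A) = fallingFactorial p γ κ m • wCoeff A m := by
  refine PowerSeries.ext fun n => ?_
  simp [symSeries, mul_comm]

lemma symSeries_injective {κ : ℤ_[p]} (hκ : ∀ k : ℕ, κ ≠ (k : ℤ_[p])) :
    Function.Injective (symSeries p γ κ) := by
  rw [← LinearMap.ker_eq_bot, LinearMap.ker_eq_bot']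
  intro A hA
  funext i
  have h1 := congrArg (fun F => PowerSeries.coeff i.1 (PowerSeries.coeff i.2 F)) hA
  simp only [coeff_symSeries, PowerSeries.coeff_smul, coeff_wCoeff, map_zero, smul_eq_mul] at h1
  exact (mul_eq_zero.mp h1).resolve_left (fallingFactorial_ne_zero hκ _)

lemma lieOp_symSeries (κ : ℤ_[p]) (M : Matrix (Fin 2) (Fin 2) (Omega p γ)⟦X⟧)
    (A : ℕ × ℕ → Omega p γ) :
    lieOp p γ κ M (symSeries p γ κ A) = symSeries p γ κ (symOp κ M A) := by
  refine PowerSeries.ext fun m => ?_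
  rw [coeff_symSeries, wCoeff_symOp]
  generalize hF : symSeries p γ κ A = F
  have hFm (m : ℕ) : PowerSeries.coeff m F =
      PowerSeries.C (fallingFactorial p γ κ m) * wCoeff A m := by
    rw [← hF, coeff_symSeries, PowerSeries.smul_eq_C_mul]
  change PowerSeries.coeff m (rowW p γ M 0 * (ofPadicInt p γ κ • F -
      PowerSeries.X * PowerSeries.derivative (Omega p γ)⟦X⟧ F) +
    rowW p γ M 1 * PowerSeries.derivative (Omega p γ)⟦X⟧ F) = _
  have hs (m : ℕ) : PowerSeries.coeff m (ofPadicInt p γ κ • F) =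
      PowerSeries.C (ofPadicInt p γ κ) * PowerSeries.coeff m F := by
    rw [PowerSeries.coeff_smul, PowerSeries.smul_eq_C_mul]
  simp only [rowW, add_mul, mul_assoc, map_add, symPart, PowerSeries.coeff_C_mul]
  rcases m with _ | m
  · simp only [PowerSeries.coeff_zero_X_mul, map_sub, hs, hFm, PowerSeries.coeff_derivative,
      PowerSeries.smul_eq_C_mul, if_true, fallingFactorial_succ, ofPadicInt_mul,
      ofPadicInt_sub, ofPadicInt_natCast, map_mul, map_natCast]
    push_cast
    ring
  · simp only [PowerSeries.coeff_succ_X_mul, map_sub, hs, hFm, PowerSeries.coeff_derivative,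
      PowerSeries.smul_eq_C_mul, if_neg (Nat.succ_ne_zero m), Nat.add_sub_cancel,
      fallingFactorial_succ, ofPadicInt_mul, ofPadicInt_sub, ofPadicInt_natCast, map_mul,
      map_natCast]
    rcases m with _ | m
    · simp only [PowerSeries.coeff_zero_X_mul]
      push_cast
      ring
    · simp only [PowerSeries.coeff_succ_X_mul, hFm, PowerSeries.coeff_derivative,
        fallingFactorial_succ, ofPadicInt_sub, ofPadicInt_natCast, map_mul, map_sub, map_natCast]
      push_cast
      ring

lemma hatPartialSym_symSeries (κ : ℤ_[p]) (H : Matrix (Fin 2) (Fin 2) (Omega p γ)⟦X⟧)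
    (A : ℕ × ℕ → Omega p γ) :
    hatPartialSym p γ κ H (symSeries p γ κ A) =
      symSeries p γ κ ((symEuler p γ + symOp κ H) A) := by
  have h : tDeriv p γ (symSeries p γ κ A) = symSeries p γ κ (symEuler p γ A) := by
    refine PowerSeries.ext fun m => PowerSeries.ext fun n => ?_
    simp [tDeriv, symSeries, symEuler, mul_assoc]
  rw [hatPartialSym, LinearMap.add_apply, h, lieOp_symSeries, ← map_add]
  rfl

/-- The indices `(n, m)` with `m ≠ 0`. -/
def positiveW : Set (ℕ × ℕ) := {i | i.2 ≠ 0}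

/-- The solution of `k(m) + (m + 2) (κ - m - 1) γ² t k(m + 2) = v(m + 1)`, by recursion on the
degree in `t`. -/
def symSolve (κ : ℤ_[p]) (v : ℕ × ℕ → Omega p γ) : ℕ → ℕ → Omega p γ
  | 0, m => v (0, m + 1)
  | n + 1, m => v (n + 1, m + 1) -
      ofPadicInt p γ (((m + 1 + 1 : ℕ) : ℤ_[p]) * (κ - (m + 1 : ℕ))) *
        (gam p γ ^ 2 * symSolve κ v n (m + 2))

lemma symPart_leadMatrix_succ (κ : ℤ_[p]) (a : ℕ → (Omega p γ)⟦X⟧) (m : ℕ) :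
    symPart κ (leadMatrix p γ) a (m + 1) = leadUnit p γ *
      (a m + (ofPadicInt p γ (((m + 1 + 1 : ℕ) : ℤ_[p]) * (κ - (m + 1 : ℕ))) * gam p γ ^ 2) •
        (X * a (m + 2))) := by
  simp only [symPart, leadMatrix, Matrix.of_apply, Matrix.cons_val_zero, Matrix.cons_val_one,
    Matrix.cons_val', Matrix.cons_val_fin_one, zero_mul, smul_zero, zero_add,
    if_neg (Nat.succ_ne_zero m), Nat.add_sub_cancel, PowerSeries.smul_eq_C_mul, map_mul]
  ring

lemma symSolve_spec (κ : ℤ_[p]) (v : ℕ × ℕ → Omega p γ) (m : ℕ) :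
    wCoeff (fun i => symSolve κ v i.1 i.2) m +
      (ofPadicInt p γ (((m + 1 + 1 : ℕ) : ℤ_[p]) * (κ - (m + 1 : ℕ))) * gam p γ ^ 2) •
        (X * wCoeff (fun i => symSolve κ v i.1 i.2) (m + 2)) = wCoeff v (m + 1) := by
  refine PowerSeries.ext fun n => ?_
  rw [map_add, PowerSeries.coeff_smul, coeff_wCoeff, coeff_wCoeff, smul_eq_mul]
  rcases n with _ | n
  · rw [PowerSeries.coeff_zero_X_mul, symSolve]
    ring
  · rw [PowerSeries.coeff_succ_X_mul, coeff_wCoeff, symSolve]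
    ring

variable {b b' : ℝ}

lemma symSolve_mem (hγ : IsSplittingRoot p γ) (hb' : b' ≤ b) (κ : ℤ_[p]) {σ : ℝ}
    {v : ℕ × ℕ → Omega p γ}
    (hv : v ∈ growthAt p γ
      (fun i : ℕ × ℕ => 2 * b' * i.1 + (b - 1 / ((p : ℝ) - 1)) * i.2) σ) :
    (fun i => symSolve κ v i.1 i.2) ∈ growthAt p γ
      (fun i : ℕ × ℕ => 2 * b' * i.1 + (b - 1 / ((p : ℝ) - 1)) * i.2)
      (σ + (b - 1 / ((p : ℝ) - 1))) := by
  rintro ⟨n, m⟩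
  change OrdGE p (symSolve κ v n m) _
  induction n generalizing m with
  | zero =>
    refine ordGE_mono p γ ?_ (hv (0, m + 1))
    push_cast
    linarith
  | succ n ih =>
    refine ordGE_sub (ordGE_mono p γ ?_ (hv (n + 1, m + 1))) ?_
    · push_cast
      linarith
    · refine ordGE_mul_of_le (ordGE_ofPadicInt _)
        (ordGE_mul p γ (s := 2 * (1 / ((p : ℝ) - 1))) ?_ (ih (m + 2))) ?_
      · rw [pow_two]
        refine ordGE_mul_of_le (ordGE_gam hγ) (ordGE_gam hγ) ?_
        linarith
      · push_cast
        linarith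

/-- The operator `∂̂_κ` in coordinates, as a perturbation of its leading part. -/
lemma isDivision_sym (hγ : IsSplittingRoot p γ) (hb0 : 1 / ((p : ℝ) - 1) < b)
    (hb : b ≤ (p : ℝ) / ((p : ℝ) - 1)) (hb' : b' ≤ b) (κ : ℤ_[p])
    {H : Matrix (Fin 2) (Fin 2) (Omega p γ)⟦X⟧}
    (hH : IsNearLead b' (b - 1 / ((p : ℝ) - 1)) H) :
    IsDivision (fun i : ℕ × ℕ => 2 * b' * i.1 + (b - 1 / ((p : ℝ) - 1)) * i.2) positiveW
      (b - 1 / ((p : ℝ) - 1)) (symOp κ (leadMatrix p γ))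
      (symEuler p γ + symOp κ (H - leadMatrix p γ)) := by
  have hu := leadUnit_mem hγ hb hb'
  obtain ⟨w, hw, huw⟩ := exists_mul_eq_one_of_mem_spaceLAt hu (constantCoeff_leadUnit hγ)
  refine ⟨by linarith, fun σ v hv => ?_, fun σ v hv => ?_, fun σ v hv => ?_, fun k hk => ?_⟩
  · rw [sub_eq_add_neg σ]
    refine symOp_mem (zero_mem _) ?_ ?_ (zero_mem _) hv
    · rw [neg_add_cancel]
      exact hu
    · refine spaceLAt_mono ?_ (gam_sq_smul_X_mul_mem hγ hb' hu)
      linarith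
  · refine add_mem (symEuler_mem hv) ?_
    have := symOp_mem (κ := κ) (M := H - leadMatrix p γ) (s := 0)
      (by simpa [leadMatrix] using hH.mem_zero_zero)
      (by simpa using hH.mem_zero_one) (by simpa using hH.mem_one_zero)
      (by simpa [leadMatrix] using hH.mem_one_one) hv
    rwa [add_zero] at this
  · let v' : ℕ × ℕ → Omega p γ := fun i => PowerSeries.coeff i.1 (w * wCoeff v i.2)
    have hv'm (m : ℕ) : wCoeff v' m = w * wCoeff v m := PowerSeries.ext fun n => by
      rw [coeff_wCoeff]
    refine ⟨fun i => symSolve κ v' i.1 i.2, symSolve_mem hγ hb' κ ?_, ?_⟩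
    · rw [mem_growthAt_iff_wCoeff] at hv ⊢
      intro m
      rw [hv'm]
      have := mul_mem_spaceLAt hw (hv m)
      rwa [zero_add] at this
    · rintro ⟨n, m⟩ hm
      obtain ⟨m, rfl⟩ := Nat.exists_eq_succ_of_ne_zero hm
      rw [Pi.sub_apply, ← coeff_wCoeff v, ← coeff_wCoeff (symOp _ _ _), wCoeff_symOp,
        symPart_leadMatrix_succ, symSolve_spec, hv'm, ← mul_assoc, huw, one_mul, sub_self]
  · have hrec (m : ℕ) : wCoeff k m +
        (ofPadicInt p γ (((m + 1 + 1 : ℕ) : ℤ_[p]) * (κ - (m + 1 : ℕ))) * gam p γ ^ 2) •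
          (X * wCoeff k (m + 2)) = 0 := by
      have h1 : symPart κ (leadMatrix p γ) (wCoeff k) (m + 1) = 0 := by
        refine PowerSeries.ext fun n => ?_
        rw [← wCoeff_symOp, coeff_wCoeff, map_zero]
        exact hk (n, m + 1) (Nat.succ_ne_zero m)
      rw [symPart_leadMatrix_succ] at h1
      have h2 := congrArg (fun f => w * f) h1
      simp only [← mul_assoc, mul_comm w (leadUnit p γ), huw, one_mul, mul_zero] at h2
      exact h2
    funext ⟨n, m⟩
    change k (n, m) = 0
    induction n generalizing m with
    | zero =>
      have := congrArg (PowerSeries.coeff 0) (hrec m)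
      rwa [map_add, PowerSeries.coeff_smul, PowerSeries.coeff_zero_X_mul, smul_zero, add_zero,
        coeff_wCoeff, map_zero] at this
    | succ n ih =>
      have := congrArg (PowerSeries.coeff (n + 1)) (hrec m)
      rwa [map_add, PowerSeries.coeff_smul, PowerSeries.coeff_succ_X_mul, coeff_wCoeff,
        coeff_wCoeff, ih, smul_zero, add_zero, map_zero] at this

lemma symEuler_add_symOp (κ : ℤ_[p]) (H : Matrix (Fin 2) (Fin 2) (Omega p γ)⟦X⟧) :
    symOp κ (leadMatrix p γ) + (symEuler p γ + symOp κ (H - leadMatrix p γ)) =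
      symEuler p γ + symOp κ H := by
  rw [symOp_sub]
  abel

lemma symSeries_of_mem_vanishing {κ : ℤ_[p]} {A : ℕ × ℕ → Omega p γ}
    (hA : A ∈ vanishing p γ positiveW) : symSeries p γ κ A = constW p γ (wCoeff A 0) := by
  refine PowerSeries.ext fun m => ?_
  change _ = PowerSeries.coeff m (PowerSeries.C (wCoeff A 0))
  rw [coeff_symSeries, PowerSeries.coeff_C]
  split_ifs with hm
  · rw [hm]
    simp [fallingFactorial, ofPadicInt]
  · have : wCoeff A m = 0 := PowerSeries.ext fun n => by
      rw [coeff_wCoeff, map_zero]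
      exact hA (n, m) hm
    rw [this, smul_zero]

lemma exists_symSeries_eq_constW {b' ε ρ : ℝ} (κ : ℤ_[p]) {f : (Omega p γ)⟦X⟧}
    (hf : f ∈ spaceLAt p γ b' ρ) : ∃ A ∈ vanishing p γ positiveW,
      A ∈ growthAt p γ (fun i : ℕ × ℕ => 2 * b' * i.1 + ε * i.2) ρ ∧
      symSeries p γ κ A = constW p γ f := by
  let A : ℕ × ℕ → Omega p γ := fun i => if i.2 = 0 then PowerSeries.coeff i.1 f else 0
  have hA : A ∈ vanishing p γ positiveW := fun i hi => if_neg hi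
  refine ⟨A, hA, ?_, ?_⟩
  · rintro ⟨n, m⟩
    change OrdGE p (if m = 0 then _ else _) _
    split_ifs with hm
    · have := mem_spaceLAt.mp hf n
      simpa [hm] using this
    · exact ordGE_zero p γ _
  · rw [symSeries_of_mem_vanishing hA]
    congr 1
    exact PowerSeries.ext fun n => coeff_wCoeff A n 0

end SymCoordinates

end KloostermanSym

end

open KloostermanSym in
theorem theoremT (p : ℕ) [Fact p.Prime] (hp : 5 ≤ p)
    (γ : PadicAlgCl p) (hγ : IsSplittingRoot p γ)
    (b b' ε : ℝ) (hb : 1 / ((p : ℝ) - 1) < b) (hb_le : b ≤ (p : ℝ) / ((p : ℝ) - 1))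
    (hb' : b' ≤ b) (hε : ε = b - 1 / ((p : ℝ) - 1))
    (κ : ℤ_[p]) (hκ : ∀ k : ℕ, κ ≠ (k : ℤ_[p])) :
    (∃! H, IsGaussManinMatrix p γ b' b H) ∧
    ∀ H, IsGaussManinMatrix p γ b' b H →
      (∀ ξ ∈ spaceS p γ κ b' ε, hatPartialSym p γ κ H ξ ∈ spaceS p γ κ b' ε) ∧
      cohomZero p γ κ b' ε H = ⊥ ∧
      (∃ e : spaceR p γ b' ≃ₗ[Omega p γ] CohomOne p γ κ b' ε H,
        ∀ r, e r = toCohomOne p γ κ b' ε H r) ∧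
      spaceSAt p γ κ b' ε 0 =
        spaceRAt p γ b' 0 ⊔
          (spaceSAt p γ κ b' ε ε).map (hatPartialSym p γ κ H).toAddMonoidHom ∧
      Disjoint (spaceRAt p γ b' 0)
        ((spaceSAt p γ κ b' ε ε).map (hatPartialSym p γ κ H).toAddMonoidHom) := by
  obtain ⟨H₀, hH₀, hnear⟩ := exists_isGaussManinMatrix hp hγ hb hb_le hb'
  refine ⟨⟨H₀, hH₀, fun H hH => hH.eq hγ hb hb_le hb' hH₀⟩, fun H hH => ?_⟩
  obtain rfl : H = H₀ := hH.eq hγ hb hb_le hb' hH₀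
  have hdiv := isDivision_sym hγ hb hb_le hb' κ hnear
  rw [← hε] at hdiv
  have hinj := symSeries_injective (γ := γ) hκ
  have happ (A : ℕ × ℕ → Omega p γ) : hatPartialSym p γ κ H (symSeries p γ κ A) =
      symSeries p γ κ ((symOp κ (leadMatrix p γ) +
        (symEuler p γ + symOp κ (H - leadMatrix p γ))) A) := by
    rw [hatPartialSym_symSeries, symEuler_add_symOp]
  have hzero {A : ℕ × ℕ → Omega p γ} {ρ σ : ℝ} {f : PowerSeries (Omega p γ)}
      (hA : A ∈ growthAt p γ (fun i : ℕ × ℕ => 2 * b' * i.1 + ε * i.2) ρ)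
      (hf : f ∈ spaceLAt p γ b' σ)
      (h : hatPartialSym p γ κ H (symSeries p γ κ A) = constW p γ f) : A = 0 := by
    obtain ⟨B, hB, -, hBf⟩ := exists_symSeries_eq_constW (ε := ε) κ hf
    rw [happ, ← hBf] at h
    refine hdiv.eq_zero_of_add_mem hA ?_
    rw [hinj h]
    exact hB
  have hdecomp {A : ℕ × ℕ → Omega p γ} {ρ : ℝ}
      (hA : A ∈ growthAt p γ (fun i : ℕ × ℕ => 2 * b' * i.1 + ε * i.2) ρ) :
      ∃ f ∈ spaceLAt p γ b' ρ,
        ∃ B ∈ growthAt p γ (fun i : ℕ × ℕ => 2 * b' * i.1 + ε * i.2) (ρ + ε),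
        symSeries p γ κ A = constW p γ f + hatPartialSym p γ κ H (symSeries p γ κ B) := by
    obtain ⟨k₀, -, hk₀⟩ := hdiv.exists_quot ρ A hA
    obtain ⟨B, hB, hr, -⟩ := hdiv.exists_add_quot hA hk₀
    have hDB := hdiv.apply_mem hB
    rw [add_sub_cancel_right] at hDB
    have hmem := mem_growthAt_iff_wCoeff.mp (sub_mem hA hDB) 0
    rw [Nat.cast_zero, mul_zero, zero_add] at hmem
    refine ⟨_, hmem, B, hB, ?_⟩
    rw [← symSeries_of_mem_vanishing hr, happ, ← map_add, sub_add_cancel]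
  have hmaps : ∀ ξ ∈ spaceS p γ κ b' ε, hatPartialSym p γ κ H ξ ∈ spaceS p γ κ b' ε := by
    rintro _ ⟨A, ⟨ρ, hA⟩, rfl⟩
    rw [happ]
    exact ⟨_, ⟨_, hdiv.apply_mem hA⟩, rfl⟩
  refine ⟨hmaps, ?_, ?_, ?_, ?_⟩
  · rw [eq_bot_iff]
    rintro ⟨_, A, ⟨ρ, hA⟩, rfl⟩ hξ
    have h0 : hatPartialSym p γ κ H (symSeries p γ κ A) = constW p γ 0 := by
      rw [map_zero]
      exact hξ
    have hA0 := hzero hA (zero_mem (spaceLAt p γ b' 0)) h0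
    subst hA0
    exact Subtype.ext (map_zero _)
  · refine ⟨LinearEquiv.ofBijective (toCohomOne p γ κ b' ε H) ⟨?_, ?_⟩, fun _ => rfl⟩
    · rw [← LinearMap.ker_eq_bot, LinearMap.ker_eq_bot']
      rintro ⟨_, f, ⟨ρ, hf⟩, rfl⟩ hr
      obtain ⟨_, ⟨A, ⟨σ, hA⟩, rfl⟩, hAf⟩ := (Submodule.Quotient.mk_eq_zero _).mp hr
      have hAf' : hatPartialSym p γ κ H (symSeries p γ κ A) = constW p γ f := hAf
      have hA0 := hzero hA hf hAf'
      subst hA0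
      refine Subtype.ext ?_
      rw [map_zero, map_zero] at hAf'
      exact hAf'.symm
    · intro q
      obtain ⟨⟨_, A, ⟨ρ, hA⟩, rfl⟩, rfl⟩ := Submodule.Quotient.mk_surjective _ q
      obtain ⟨f, hf, B, hB, hAB⟩ := hdecomp hA
      refine ⟨⟨constW p γ f, f, ⟨ρ, hf⟩, rfl⟩, ?_⟩
      refine (Submodule.Quotient.eq _).mpr ?_
      refine ⟨symSeries p γ κ (-B), ⟨-B, ⟨_, neg_mem hB⟩, rfl⟩, ?_⟩
      change _ = constW p γ f - symSeries p γ κ A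
      rw [hAB, map_neg, map_neg]
      abel
  · apply le_antisymm
    · rintro _ ⟨A, hA, rfl⟩
      obtain ⟨f, hf, B, hB, hAB⟩ := hdecomp hA
      rw [zero_add] at hB
      change symSeries p γ κ A ∈ _
      rw [hAB]
      exact AddSubgroup.add_mem_sup ⟨f, hf, rfl⟩ ⟨_, ⟨B, hB, rfl⟩, rfl⟩
    · refine sup_le ?_ ?_
      · rintro _ ⟨f, hf, rfl⟩
        obtain ⟨A, -, hA, hAf⟩ := exists_symSeries_eq_constW (ε := ε) κ hf
        exact ⟨A, hA, hAf⟩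
      · rintro _ ⟨_, ⟨A, hA, rfl⟩, rfl⟩
        have h := hdiv.apply_mem hA
        rw [sub_self] at h
        exact ⟨_, h, (happ A).symm⟩
  · rw [AddSubgroup.disjoint_def]
    rintro _ ⟨f, hf, rfl⟩ ⟨_, ⟨A, hA, rfl⟩, hAf⟩
    have hAf' : hatPartialSym p γ κ H (symSeries p γ κ A) = constW p γ f := hAf
    have hA0 := hzero hA hf hAf'
    subst hA0
    rw [map_zero, map_zero] at hAf'
    exact hAf'.symm
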